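/- Let $X_1,X_2,\dots$ be i.i.d. real random variables, $S_0=0$ and $S_n=X_1+\dots+X_n$. Say that a (weak) record occurs at step $n\ge 0$ if $S_n=\max_{0\le k\le n}S_k$; let $R_n$ be the number of records among the steps $0,1,\dots,n$ (so $R_0=1$), and let $T_1=\inf\{n\ge 1: S_n\ge S_j \text{ for all } 0\le j\le n\}$ be the first ladder epoch. Put $\Lambda(\lambda)=\log \mathbb E(e^{\lambda T_1})$ for $\lambda\le 0$ and $\Lambda^*(y)=\sup_{\lambda\le 0}(\lambda y-\Lambda(\lambda))\in[-\infty,+\infty]$ for $y\in\mathbb R$. (a) Suppose that $S$ oscillates, i.e. almost surely $\limsup_n S_n=+\infty$ and $\liminf_n S_n=-\infty$. Then for every $0<y\le 1$, $$\lim_{n\to\infty}\frac1n\log \mathbb P(R_n\ge ny)=-y\,\Lambda^*\!\left(\frac1y\right).$$ Moreover $\Lambda$ is differentiable on $(-\infty,0)$; for each $y>1$ there is exactly one $\lambda<0$ with $\Lambda'(\lambda)=y$, denoted $(\Lambda')^{-1}(y)$; and $$\Lambda^*(y)=\begin{cases}(\Lambda')^{-1}(y)\,y-\Lambda\big[(\Lambda')^{-1}(y)\big],&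 y>1,\\ -\log \mathbb P(X_1\ge 0),& y=1,\\ +\infty,& y<1.\end{cases}$$ (b) Suppose that $S$ drifts to $+\infty$, i.e. $S_n\to+\infty$ almost surely. Then $$\mathbb E(T_1)=\exp\Big\{\sum_{k=1}^\infty \frac{\mathbb P(S_k<0)}{k}\Big\}<+\infty ,\qquad \frac{R_n}{n}\to\frac1{\mathbb E(T_1)}\ \text{ almost surely},$$ and for every $y$ with $1/\mathbb E(T_1)<y\le 1$, $$\lim_{n\to\infty}\frac1n\log \mathbb P(R_n\ge ny)=-y\,\Lambda^*\!\left(\frac1y\right).$$ Moreover $\Lambda$ is differentiable on $(-\infty,0)$; for each $1<y<\mathbb E(T_1)$ there is exactly one $\lambda<0$ with $\Lambda'(\lambda)=y$, denoted $(\Lambda')^{-1}(y)$; and $$\Lambda^*(y)=\begin{cases}(\Lambda')^{-1}(y)\,y-\Lambda\big[(\Lambda')^{-1}(y)\big],& 1<y<\mathbb E(T_1),\\ -\log \mathbb P(X_1\ge 0),& y=1,\\ +\infty,& y<1.\end{cases}$$ -/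

import Mathlib

open MeasureTheory ProbabilityTheory Filter Topology Set
open scoped ENNReal

namespace RandomWalk

variable {Ω : Type*}

/-- The random walk `S_n = X_1 + ⋯ + X_n`, `S_0 = 0`; the step `X_{i+1}` is `X i`. -/
def walk (X : ℕ → Ω → ℝ) (n : ℕ) (ω : Ω) : ℝ := ∑ i ∈ Finset.range n, X i ω

/-- A (weak) record occurs at step `n`: `S_n = max_{0 ≤ k ≤ n} S_k`. -/
def IsRecord (X : ℕ → Ω → ℝ) (ω : Ω) (n : ℕ) : Prop :=
  ∀ k ≤ n, walk X k ω ≤ walk X n ω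

open Classical in
/-- `R_n`, the number of weak records among the steps `0, 1, …, n`. -/
noncomputable def recordCount (X : ℕ → Ω → ℝ) (n : ℕ) (ω : Ω) : ℕ :=
  ((Finset.range (n + 1)).filter (fun k => IsRecord X ω k)).card

/-- The first (weak) ladder epoch `T_1 = inf {n ≥ 1 : S_n ≥ S_j for all j ≤ n}`, with value
`∞` if there is no such `n`. -/
noncomputable def ladderEpoch (X : ℕ → Ω → ℝ) (ω : Ω) : ℕ∞ :=
  ⨅ n ∈ {n : ℕ | 1 ≤ n ∧ IsRecord X ω n}, (n : ℕ∞)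

variable [MeasurableSpace Ω]

/-- The walk oscillates: almost surely `limsup S_n = +∞` and `liminf S_n = -∞`. -/
def Oscillates (X : ℕ → Ω → ℝ) (μ : Measure Ω) : Prop :=
  ∀ᵐ ω ∂μ, limsup (fun n => (walk X n ω : EReal)) atTop = ⊤ ∧
    liminf (fun n => (walk X n ω : EReal)) atTop = ⊥

/-- The walk drifts to `+∞`: almost surely `S_n → +∞`. -/
def DriftsToInfinity (X : ℕ → Ω → ℝ) (μ : Measure Ω) : Prop :=
  ∀ᵐ ω ∂μ, Tendsto (fun n => walk X n ω) atTop atTop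

/-- `E(T_1)`, possibly infinite. -/
noncomputable def meanLadderEpoch (X : ℕ → Ω → ℝ) (μ : Measure Ω) : ℝ≥0∞ :=
  ∫⁻ ω, (ladderEpoch X ω : ℝ≥0∞) ∂μ

/-- The cumulant generating function `Λ(t) = log E(exp (t T_1))`. It is used for `t ≤ 0` only,
where the expectation is finite and positive, and for walks that oscillate or drift to `+∞`,
for which `T_1` is almost surely finite (so that the value of `toNat` at `∞` plays no role). -/
noncomputable def ladderCgf (X : ℕ → Ω → ℝ) (μ : Measure Ω) (t : ℝ) : ℝ :=
  cgf (fun ω => ((ladderEpoch X ω).toNat : ℝ)) μ t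

/-- The Legendre transform `Λ*(y) = sup_{t ≤ 0} (t y - Λ(t))`, with values in `[-∞, ∞]`. -/
noncomputable def ladderRate (X : ℕ → Ω → ℝ) (μ : Measure Ω) (y : ℝ) : EReal :=
  ⨆ t : Iic (0 : ℝ), ((t * y - ladderCgf X μ t : ℝ) : EReal)

/-- `(Λ')⁻¹`, the inverse of the restriction of `Λ'` to the negative half-line. -/
noncomputable def ladderCgfDerivInv (X : ℕ → Ω → ℝ) (μ : Measure Ω) : ℝ → ℝ :=
  Function.invFunOn (deriv (ladderCgf X μ)) (Iio 0)

end RandomWalk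

namespace RandomWalk

/-! ### Deterministic facts on records of a sequence of steps -/

/-! At a record the walk sits at its running maximum, so what follows the first positive record is a
fresh copy of the walk, independent of the past. The time `recordTime k` of the `k`-th positive
record is therefore a sum of `k` independent copies of `T = firstRecord`
(`indepFun_firstRecord_afterRecord`, `mgf_recordTime`). Counting records inverts these times: almost
surely `R_n ≥ k + 1` if and only if `recordTime k ≤ n` (`recordTime_le_iff`). The large deviations
of `R_n` are thus Cramér's theorem for the lower tail of `recordTime k`
(`tendsto_log_measure_lowerTail`), valid for levels `1 / y` below `E T`, and the law of large
numbers for `R_n` is that of `recordTime k` inverted (`tendsto_numRecords_div`).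

It remains to know `E T`. Decomposing at the last record before `N` (`sum_lastRecord`), with
`P(record at j) = P(S_0, …, S_j ≥ 0)` by time reversal (`measure_hasRecord`), shows that `E T` is
finite if and only if the walk stays nonnegative forever with positive probability. This fails for
an oscillating walk and holds for one drifting to `+∞`.

The value of `E T` comes from the Sparre Andersen identity `-log (1 - E z^T) = ∑ z^n P(S_n ≥ 0) /
n`. If `S_n ≥ 0`, the cyclic rotations of the `n` steps that end in a record all have the same
number of records before the end, and this number is also the number of such rotations; weighting
each by its inverse gives total weight one (`sum_rotation`). Taking expectations gives `P(S_n ≥ 0) /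
n = ∑_k P(recordTime k = n) / k`, and summing over `n` produces the logarithm. Letting `z ↑ 1`,
Abel's theorem yields the exponential formula (`mean_firstRecord`).

All of this takes place on the space of step sequences with the product law; the final section
carries it back to `Ω`. -/

/-- The partial sums of a sequence of steps. -/
def partialSum (x : ℕ → ℝ) (n : ℕ) : ℝ := ∑ i ∈ Finset.range n, x i

/-- The partial sums of `x` have a weak record at `n`. -/
def HasRecord (x : ℕ → ℝ) (n : ℕ) : Prop := ∀ k ≤ n, partialSum x k ≤ partialSum x n

open Classical in
/-- The number of weak records at `0, …, n`. -/
noncomputable def numRecords (x : ℕ → ℝ) (n : ℕ) : ℕ :=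
  ((Finset.range (n + 1)).filter (fun k => HasRecord x k)).card

/-- The sequence of steps with its first `m` terms removed. -/
def shift (m : ℕ) (x : ℕ → ℝ) : ℕ → ℝ := fun i => x (i + m)

/-- The first positive record time, `0` if there is none. -/
noncomputable def firstRecord (x : ℕ → ℝ) : ℕ := sInf {n | 1 ≤ n ∧ HasRecord x n}

/-- The sequence of steps after the first positive record time. -/
noncomputable def afterRecord (x : ℕ → ℝ) : ℕ → ℝ := shift (firstRecord x) x

/-- The time of the `k`-th positive record. -/
noncomputable def recordTime : ℕ → (ℕ → ℝ) → ℕ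
  | 0, _ => 0
  | k + 1, x => firstRecord x + recordTime k (afterRecord x)

lemma partialSum_shift (m : ℕ) (x : ℕ → ℝ) (n : ℕ) :
    partialSum (shift m x) n = partialSum x (m + n) - partialSum x m := by
  rw [partialSum, partialSum, partialSum, Finset.sum_range_add, add_sub_cancel_left]
  exact Finset.sum_congr rfl fun i _ => by rw [shift, add_comm]

lemma partialSum_congr {x y : ℕ → ℝ} {n : ℕ} (h : ∀ i < n, x i = y i) :
    partialSum x n = partialSum y n :=
  Finset.sum_congr rfl fun i hi => h i (Finset.mem_range.1 hi)

lemma hasRecord_zero (x : ℕ → ℝ) : HasRecord x 0 := by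
  intro k hk
  rw [Nat.le_zero.1 hk]

lemma hasRecord_congr {x y : ℕ → ℝ} {n : ℕ} (h : ∀ i < n, x i = y i) :
    HasRecord x n ↔ HasRecord y n := by
  have key : ∀ k ≤ n, partialSum x k = partialSum y k := fun k hk =>
    partialSum_congr fun i hi => h i (hi.trans_le hk)
  constructor <;> intro H k hk <;> have := H k hk <;>
    simpa only [key k hk, key n le_rfl] using this

/-- At a record `m` the walk equals its running maximum, so a later value dominates the whole past
as soon as it dominates the values from `m` on. -/
lemma hasRecord_shift_iff {x : ℕ → ℝ} {m : ℕ} (hm : HasRecord x m) (n : ℕ) :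
    HasRecord (shift m x) n ↔ HasRecord x (m + n) := by
  constructor
  · intro H k hk
    rcases le_total k m with h | h
    · have h0 := H 0 (Nat.zero_le _)
      rw [partialSum_shift, partialSum_shift, add_zero] at h0
      linarith [hm k h]
    · obtain ⟨j, rfl⟩ := Nat.exists_eq_add_of_le h
      have := H j (by omega)
      rw [partialSum_shift, partialSum_shift] at this
      linarith
  · intro H k hk
    rw [partialSum_shift, partialSum_shift]
    linarith [H (m + k) (by omega)]

lemma firstRecord_spec {x : ℕ → ℝ} (h : ∃ n, 1 ≤ n ∧ HasRecord x n) :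
    1 ≤ firstRecord x ∧ HasRecord x (firstRecord x) :=
  Nat.sInf_mem (s := {n | 1 ≤ n ∧ HasRecord x n}) h

lemma firstRecord_le {x : ℕ → ℝ} {n : ℕ} (h1 : 1 ≤ n) (hn : HasRecord x n) :
    firstRecord x ≤ n :=
  Nat.sInf_le ⟨h1, hn⟩

lemma firstRecord_eq_iff {x : ℕ → ℝ} {a : ℕ} (ha : 1 ≤ a) :
    firstRecord x = a ↔ HasRecord x a ∧ ∀ k, 1 ≤ k → k < a → ¬ HasRecord x k := by
  constructor
  · rintro rfl
    have hne : {n | 1 ≤ n ∧ HasRecord x n}.Nonempty := by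
      by_contra hne
      rw [not_nonempty_iff_eq_empty] at hne
      rw [firstRecord, hne, Nat.sInf_empty] at ha
      omega
    exact ⟨(firstRecord_spec hne).2, fun k hk hka hr => (firstRecord_le hk hr).not_gt hka⟩
  · rintro ⟨h1, h2⟩
    refine le_antisymm (firstRecord_le ha h1) ?_
    by_contra hlt
    have hs := firstRecord_spec ⟨a, ha, h1⟩
    exact h2 _ hs.1 (not_le.1 hlt) hs.2

lemma numRecords_of_lt {x : ℕ → ℝ} {n : ℕ} (h : n < firstRecord x) : numRecords x n = 1 := by
  classical
  rw [numRecords, Finset.card_eq_one]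
  refine ⟨0, Finset.ext fun k => ?_⟩
  simp only [Finset.mem_filter, Finset.mem_range, Finset.mem_singleton]
  constructor
  · rintro ⟨hk, hr⟩
    by_contra h0
    have := firstRecord_le (Nat.one_le_iff_ne_zero.2 h0) hr
    omega
  · rintro rfl
    exact ⟨by omega, hasRecord_zero x⟩

lemma numRecords_eq_count (x : ℕ → ℝ) (n : ℕ) [DecidablePred (HasRecord x)] :
    numRecords x n = Nat.count (HasRecord x) (n + 1) := by
  rw [Nat.count_eq_card_filter_range, numRecords]
  congr

/-- The summand 1 is the record at index 0; the first positive record is index 0 of the restarted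
walk and is counted there. -/
lemma numRecords_of_le {x : ℕ → ℝ} (hx : ∃ n, 1 ≤ n ∧ HasRecord x n) {n : ℕ}
    (h : firstRecord x ≤ n) :
    numRecords x n = 1 + numRecords (afterRecord x) (n - firstRecord x) := by
  classical
  obtain ⟨h1, h2⟩ := firstRecord_spec hx
  have e : n + 1 = (firstRecord x - 1 + 1) + (n - firstRecord x + 1) := by omega
  rw [numRecords_eq_count, e, Nat.count_add, ← numRecords_eq_count,
    numRecords_of_lt (by omega), numRecords_eq_count]
  congr 1
  simp only [Nat.count_eq_card_filter_range]
  congr 1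
  refine Finset.filter_congr fun k _ => ?_
  rw [afterRecord, hasRecord_shift_iff h2, Nat.sub_add_cancel h1]

/-- Times and counts are inverse to each other. The `+ 1` accounts for the record at index 0. A next
record must exist after every restart, since `firstRecord` takes the default value 0 otherwise. -/
lemma recordTime_le_iff {k : ℕ} {x : ℕ → ℝ}
    (hx : ∀ i, ∃ n, 1 ≤ n ∧ HasRecord (afterRecord^[i] x) n) (n : ℕ) :
    recordTime k x ≤ n ↔ k + 1 ≤ numRecords x n := by
  classical
  induction k generalizing x n with
  | zero =>
    simp only [recordTime, Nat.zero_le, zero_add, true_iff]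
    rw [numRecords, Nat.one_le_iff_ne_zero, Finset.card_ne_zero]
    exact ⟨0, by simp [hasRecord_zero]⟩
  | succ k ih =>
    have h0 : ∃ n, 1 ≤ n ∧ HasRecord x n := hx 0
    have ih' := @ih (afterRecord x) (fun i => by simpa using hx (i + 1))
    rw [recordTime]
    rcases lt_or_ge n (firstRecord x) with h | h
    · rw [numRecords_of_lt h]
      omega
    · rw [numRecords_of_le h0 h, add_comm 1, add_le_add_iff_right, ← ih']
      omega

lemma recordTime_eq_sum (k : ℕ) (x : ℕ → ℝ) :
    recordTime k x = ∑ i ∈ Finset.range k, firstRecord (afterRecord^[i] x) := by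
  induction k generalizing x with
  | zero => rfl
  | succ k ih => rw [recordTime, ih, Finset.sum_range_succ', add_comm]; rfl

lemma numRecords_succ (x : ℕ → ℝ) (n : ℕ) [Decidable (HasRecord x (n + 1))] :
    numRecords x (n + 1) = numRecords x n + if HasRecord x (n + 1) then 1 else 0 := by
  classical
  rw [numRecords_eq_count, Nat.count_succ, ← numRecords_eq_count]
  congr

lemma recordTime_eq_iff {k : ℕ} {x : ℕ → ℝ}
    (hx : ∀ i, ∃ n, 1 ≤ n ∧ HasRecord (afterRecord^[i] x) n) (n : ℕ) :
    recordTime k x = n + 1 ↔ HasRecord x (n + 1) ∧ numRecords x n = k := by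
  classical
  have h1 := recordTime_le_iff (k := k) hx n
  have h2 := recordTime_le_iff (k := k) hx (n + 1)
  rw [numRecords_succ] at h2
  split_ifs at h2 with h
  · rw [and_iff_right h]
    omega
  · rw [iff_false_right (fun h' => h h'.1)]
    omega

/-! ### Cyclic rearrangements -/

/-- The injection of `ℕ` rotating `{0, …, n - 1}` by `v` and fixing the other integers. -/
def rotation (n v : ℕ) (i : ℕ) : ℕ := if i < n then (i + v) % n else i

lemma rotation_injective (n v : ℕ) : Function.Injective (rotation n v) := by
  intro i j h
  unfold rotation at h
  split_ifs at h with hi hj hj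
  · have h' : i + v ≡ j + v [MOD n] := h
    exact (Nat.ModEq.add_right_cancel' v h').eq_of_lt_of_lt hi hj
  · have := Nat.mod_lt (i + v) (by omega : 0 < n)
    omega
  · have := Nat.mod_lt (j + v) (by omega : 0 < n)
    omega
  · exact h

lemma partialSum_periodic {y : ℕ → ℝ} {n : ℕ} (hy : ∀ i, y (i + n) = y i) (j : ℕ) :
    partialSum y (j + n) = partialSum y j + partialSum y n := by
  have := partialSum_shift n y j
  have h2 : partialSum (shift n y) j = partialSum y j := partialSum_congr fun i _ => hy i
  rw [add_comm j]
  linarith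

/-- Call `v` good if the period started at `v` ends in a record. Inside a good period, the records
sit exactly at the other good starting points, because prolonging the path by a period only adds the
same increment. -/
lemma hasRecord_shift_periodic_iff {y : ℕ → ℝ} {n : ℕ} (hy : ∀ i, y (i + n) = y i) {v j : ℕ}
    (hv : HasRecord (shift v y) n) (hj : j ≤ n) :
    HasRecord (shift v y) j ↔ HasRecord (shift (v + j) y) n := by
  have P := fun j => partialSum_periodic hy j
  simp only [HasRecord, partialSum_shift] at hv ⊢
  constructor
  · intro H i hi
    rcases le_total (j + i) n with h | h
    · have h1 := hv (j + i) h
      have h2 := H 0 (Nat.zero_le _)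
      rw [← add_assoc] at h1
      rw [P] at h1 ⊢
      rw [add_zero] at h2
      linarith
    · have h1 := H (j + i - n) (by omega)
      have e : v + j + i = v + (j + i - n) + n := by omega
      rw [e, P, P]
      linarith
  · intro H i hi
    have h1 := H (i + n - j) (by omega)
    have e : v + j + (i + n - j) = v + i + n := by omega
    rw [e, P, P] at h1
    linarith

lemma hasRecord_shift_add_period {y : ℕ → ℝ} {n : ℕ} (hy : ∀ i, y (i + n) = y i) (v : ℕ) :
    HasRecord (shift (v + n) y) n ↔ HasRecord (shift v y) n := by
  have : shift (v + n) y = shift v y := by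
    funext i
    simp only [shift, ← add_assoc, hy]
  rw [this]

/-- Start where the partial sums are maximal over one period: no later value within the period
exceeds the start by more than the period sum, which is nonnegative. -/
lemma exists_hasRecord_shift {y : ℕ → ℝ} {n : ℕ} (hn : 1 ≤ n) (hy : ∀ i, y (i + n) = y i)
    (h0 : 0 ≤ partialSum y n) : ∃ v < n, HasRecord (shift v y) n := by
  have P := fun j => partialSum_periodic hy j
  obtain ⟨v, hv, hmax⟩ := Finset.exists_max_image (Finset.range n) (partialSum y)
    ⟨0, Finset.mem_range.2 hn⟩
  rw [Finset.mem_range] at hv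
  refine ⟨v, hv, fun i hi => ?_⟩
  rw [partialSum_shift, partialSum_shift, P]
  rcases lt_or_ge (v + i) n with h | h
  · linarith [hmax _ (Finset.mem_range.2 h)]
  · have e : v + i = v + i - n + n := by omega
    rw [e, P]
    linarith [hmax _ (Finset.mem_range.2 (show v + i - n < n by omega))]

-- Combinatorial core of the Sparre Andersen identity. Each good rotation has as many records at `0,
-- …, n` as there are good rotations, so their weights sum to one as soon as one exists, that is,
-- when the total is nonnegative. The endpoint `n + 1` is left out of the count so that each residue
-- occurs once.
open Classical in
lemma sum_rotation (x : ℕ → ℝ) (n : ℕ) :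
    ∑ v ∈ Finset.range (n + 1), (if HasRecord (x ∘ rotation (n + 1) v) (n + 1) then
        (1 / (numRecords (x ∘ rotation (n + 1) v) n : ℝ)) else 0) =
      if 0 ≤ partialSum x (n + 1) then 1 else 0 := by
  set y : ℕ → ℝ := fun i => x (i % (n + 1)) with hydef
  have hy : ∀ i, y (i + (n + 1)) = y i := fun i => by simp [hydef]
  have hrec : ∀ v, ∀ j ≤ n + 1, HasRecord (x ∘ rotation (n + 1) v) j ↔ HasRecord (shift v y) j := by
    intro v j hj
    refine hasRecord_congr fun i hi => ?_
    simp only [Function.comp, rotation, shift, hydef, if_pos (hi.trans_le hj)]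
  set G : ℕ → Prop := fun v => HasRecord (shift v y) (n + 1) with hG
  have hGper : Function.Periodic G (n + 1) := fun v =>
    propext (hasRecord_shift_add_period hy v)
  have hcount : ∀ v, G v → numRecords (x ∘ rotation (n + 1) v) n = Nat.count G (n + 1) := by
    intro v hv
    -- Good starting points may be counted over any full period; over the one beginning at `v`, a
    -- record `k` corresponds to the starting point `v + k`.
    rw [← Nat.filter_Ico_card_eq_of_periodic v (n + 1) G hGper, numRecords]
    refine Finset.card_bij (fun k _ => v + k) ?_ ?_ ?_
    · intro k hk
      simp only [Finset.mem_filter, Finset.mem_range, Finset.mem_Ico] at hk ⊢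
      exact ⟨by omega, (hasRecord_shift_periodic_iff hy hv hk.1.le).1 ((hrec v k hk.1.le).1 hk.2)⟩
    · intro a _ b _ hab
      omega
    · intro b hb
      simp only [Finset.mem_filter, Finset.mem_Ico] at hb
      refine ⟨b - v, ?_, by omega⟩
      simp only [Finset.mem_filter, Finset.mem_range]
      refine ⟨by omega, (hrec v _ (by omega)).2
        ((hasRecord_shift_periodic_iff hy hv (by omega)).2 ?_)⟩
      rw [show v + (b - v) = b by omega]
      exact hb.2
  have hsum : partialSum y (n + 1) = partialSum x (n + 1) :=
    partialSum_congr fun i hi => by simp [hydef, Nat.mod_eq_of_lt hi]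
  have hterm : ∀ v ∈ Finset.range (n + 1),
      (if HasRecord (x ∘ rotation (n + 1) v) (n + 1) then
        (1 / (numRecords (x ∘ rotation (n + 1) v) n : ℝ)) else 0) =
      if G v then 1 / (Nat.count G (n + 1) : ℝ) else 0 := by
    intro v _
    by_cases h : G v
    · rw [if_pos ((hrec v _ le_rfl).2 h), if_pos h, hcount v h]
    · rw [if_neg (fun h' => h ((hrec v _ le_rfl).1 h')), if_neg h]
  rw [Finset.sum_congr rfl hterm, ← Finset.sum_filter, Finset.sum_const, nsmul_eq_mul,
    ← Nat.count_eq_card_filter_range]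
  split_ifs with h
  · rw [← hsum] at h
    obtain ⟨v, hv, hGv⟩ := exists_hasRecord_shift (Nat.le_add_left 1 n) hy h
    have : (Nat.count G (n + 1) : ℝ) ≠ 0 := by
      rw [Nat.cast_ne_zero, Nat.count_eq_card_filter_range, Finset.card_ne_zero]
      exact ⟨v, Finset.mem_filter.2 ⟨Finset.mem_range.2 hv, hGv⟩⟩
    field_simp
  · have : Nat.count G (n + 1) = 0 := by
      rw [Nat.count_eq_card_filter_range, Finset.card_eq_zero, Finset.filter_eq_empty_iff]
      intro v _ hGv
      apply h
      have := hGv 0 (Nat.zero_le _)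
      rw [partialSum_shift, partialSum_shift, partialSum_periodic hy, add_zero, hsum] at this
      linarith
    simp [this]

/-! ### Measurability -/

lemma measurable_partialSum (n : ℕ) : Measurable (fun x : ℕ → ℝ => partialSum x n) := by
  unfold partialSum
  fun_prop

lemma measurableSet_hasRecord (n : ℕ) : MeasurableSet {x : ℕ → ℝ | HasRecord x n} := by
  simp only [HasRecord, ofPred_forall]
  exact MeasurableSet.iInter fun k => MeasurableSet.iInter fun _ =>
    measurableSet_le (measurable_partialSum k) (measurable_partialSum n)

lemma measurableSet_firstRecord_eq {a : ℕ} (ha : 1 ≤ a) :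
    MeasurableSet {x : ℕ → ℝ | firstRecord x = a} := by
  simp only [firstRecord_eq_iff ha, ofPred_and, ofPred_forall]
  exact (measurableSet_hasRecord a).inter (MeasurableSet.iInter fun k => MeasurableSet.iInter
    fun _ => MeasurableSet.iInter fun _ => (measurableSet_hasRecord k).compl)

lemma measurable_firstRecord : Measurable firstRecord := by
  refine measurable_to_countable' fun a => ?_
  rcases Nat.eq_zero_or_pos a with rfl | ha
  · have : firstRecord ⁻¹' {0} = (⋃ a ∈ Ici 1, {x : ℕ → ℝ | firstRecord x = a})ᶜ := by
      ext x
      simp only [mem_preimage, mem_singleton_iff, mem_compl_iff, mem_iUnion, mem_ofPred_eq, mem_Ici,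
        exists_prop, exists_eq_right']
      omega
    rw [this]
    exact (MeasurableSet.biUnion (to_countable _) fun a ha => measurableSet_firstRecord_eq ha).compl
  · exact measurableSet_firstRecord_eq ha

lemma measurable_shift (m : ℕ) : Measurable (shift m) := by
  unfold shift
  fun_prop

lemma measurable_afterRecord : Measurable afterRecord := by
  have h : Measurable (fun p : (ℕ → ℝ) × ℕ => shift p.2 p.1) :=
    measurable_from_prod_countable_left measurable_shift
  exact h.comp (measurable_id.prodMk measurable_firstRecord)

lemma measurable_recordTime (k : ℕ) : Measurable (recordTime k) := by
  induction k with
  | zero => exact measurable_const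
  | succ k ih => exact measurable_firstRecord.add (ih.comp measurable_afterRecord)

lemma measurable_numRecords (n : ℕ) : Measurable (fun x : ℕ → ℝ => numRecords x n) := by
  classical
  have : (fun x : ℕ → ℝ => numRecords x n) = fun x =>
      ∑ k ∈ Finset.range (n + 1), {x : ℕ → ℝ | HasRecord x k}.indicator (fun _ => 1) x := by
    funext x
    rw [numRecords, Finset.card_filter]
    refine Finset.sum_congr rfl fun k _ => ?_
    simp [indicator_apply]
  rw [this]
  exact Finset.measurable_sum _ fun k _ => measurable_const.indicator (measurableSet_hasRecord k)

/-! ### The law of an i.i.d. sequence of steps -/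

/-- The law of a sequence of independent steps with law `ρ`. -/
noncomputable abbrev seqLaw (ρ : Measure ℝ) [IsProbabilityMeasure ρ] : Measure (ℕ → ℝ) :=
  Measure.infinitePi (fun _ => ρ)

variable {ρ : Measure ℝ} [IsProbabilityMeasure ρ]

lemma measurePreserving_comp {e : ℕ → ℕ} (he : Function.Injective e) :
    MeasurePreserving (fun x : ℕ → ℝ => x ∘ e) (seqLaw ρ) (seqLaw ρ) :=
  ⟨by unfold Function.comp; fun_prop,
    Measure.map_infinitePi_infinitePi_of_inj (P := fun _ : ℕ => ρ) he⟩

lemma measurePreserving_shift (m : ℕ) : MeasurePreserving (shift m) (seqLaw ρ) (seqLaw ρ) :=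
  measurePreserving_comp (add_left_injective m)

/-- The past and the future of the sequence of steps are independent. -/
lemma measure_inter_shift {n : ℕ} {A B : Set (ℕ → ℝ)} (hA : MeasurableSet A)
    (hB : MeasurableSet B)
    (hdep : ∀ x y : ℕ → ℝ, (∀ i < n, x i = y i) → x ∈ A → y ∈ A) :
    seqLaw ρ (A ∩ shift n ⁻¹' B) = seqLaw ρ A * seqLaw ρ B := by
  have hind : iIndepFun (fun (i : ℕ) (x : ℕ → ℝ) => x i) (seqLaw ρ) :=
    iIndepFun_infinitePi (X := fun _ x => x) (fun _ => measurable_id)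
  have h := indep_iSup_of_disjoint (fun i => (measurable_pi_apply i).comap_le) hind.iIndep
    (S := Iio n) (T := Ici n) (by
      rw [Set.disjoint_left]
      intro a ha hb
      exact absurd (mem_Iio.1 ha) (not_lt.2 hb))
  have hcoord : ∀ (S : Set ℕ) (i : ℕ), i ∈ S →
      Measurable[⨆ i ∈ S, (inferInstance : MeasurableSpace ℝ).comap fun x : ℕ → ℝ => x i]
        (fun x : ℕ → ℝ => x i) := by
    intro S i hi
    exact (comap_measurable _).mono
      (le_iSup₂ (f := fun i (_ : i ∈ S) => (inferInstance : MeasurableSpace ℝ).comap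
        fun x : ℕ → ℝ => x i) i hi) le_rfl
  have hmp := measurePreserving_shift (ρ := ρ) n
  rw [(Indep_iff _ _ _).1 h A (shift n ⁻¹' B) ?_ ?_, hmp.measure_preimage hB.nullMeasurableSet]
  -- `A` depends only on the first `n` coordinates, so it is unchanged when the others are replaced
  -- by 0; this truncation is measurable for the past.
  · have hAe : A = (fun (x : ℕ → ℝ) i => if i < n then x i else 0) ⁻¹' A := by
      ext x
      exact ⟨hdep _ _ fun i hi => by simp [hi], hdep _ _ fun i hi => by simp [hi]⟩
    have hm : Measurable[⨆ i ∈ Iio n, (inferInstance : MeasurableSpace ℝ).comap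
        fun x : ℕ → ℝ => x i] (fun (x : ℕ → ℝ) i => if i < n then x i else 0) := by
      refine @measurable_pi_lambda _ _ _ (_) _ _ fun i => ?_
      by_cases hi : i < n
      · simp only [hi, if_true]
        exact hcoord _ i hi
      · simp only [hi, if_false]
        exact measurable_const
    rw [hAe]
    exact hm hA
  · have hm : Measurable[⨆ i ∈ Ici n, (inferInstance : MeasurableSpace ℝ).comap
        fun x : ℕ → ℝ => x i] (shift n) :=
      @measurable_pi_lambda _ _ _ (_) _ _ fun i => hcoord _ (i + n) (mem_Ici.2 (by omega))
    exact hm hB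

/-- Almost surely there is a positive record time. -/
def RecordsOccur (ρ : Measure ℝ) [IsProbabilityMeasure ρ] : Prop :=
  ∀ᵐ x ∂(seqLaw ρ), ∃ n, 1 ≤ n ∧ HasRecord x n

/-- Strong Markov property at the first record: `firstRecord = a` is decided by the first `a` steps,
and on it `afterRecord` is the shift by the fixed time `a`. -/
lemma measure_firstRecord_inter {a : ℕ} (ha : 1 ≤ a) {B : Set (ℕ → ℝ)} (hB : MeasurableSet B) :
    seqLaw ρ ({x | firstRecord x = a} ∩ afterRecord ⁻¹' B) =
      seqLaw ρ {x | firstRecord x = a} * seqLaw ρ B := by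
  rw [← measure_inter_shift (n := a) (measurableSet_firstRecord_eq ha) hB]
  · congr 1
    ext x
    simp only [mem_inter_iff, mem_ofPred_eq, mem_preimage, afterRecord]
    refine and_congr_right fun h => ?_
    rw [h]
  · intro x y hxy
    simp only [mem_ofPred_eq, firstRecord_eq_iff ha]
    rintro ⟨h1, h2⟩
    exact ⟨(hasRecord_congr hxy).1 h1, fun k hk hka hr =>
      h2 k hk hka ((hasRecord_congr fun i hi => hxy i (hi.trans hka)).2 hr)⟩

lemma measure_firstRecord_zero (h : RecordsOccur ρ) : seqLaw ρ {x | firstRecord x = 0} = 0 := by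
  refine measure_mono_null (t := {x | ¬ ∃ n, 1 ≤ n ∧ HasRecord x n}) ?_ h
  intro x hx hn
  have := (firstRecord_spec hn).1
  rw [mem_ofPred_eq] at hx
  omega

/-- The default value `a = 0` has probability zero when records occur. -/
lemma measure_firstRecord_inter' (h : RecordsOccur ρ) (a : ℕ) {B : Set (ℕ → ℝ)}
    (hB : MeasurableSet B) :
    seqLaw ρ ({x | firstRecord x = a} ∩ afterRecord ⁻¹' B) =
      seqLaw ρ {x | firstRecord x = a} * seqLaw ρ B := by
  rcases Nat.eq_zero_or_pos a with rfl | ha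
  · rw [measure_firstRecord_zero h, zero_mul]
    exact measure_mono_null inter_subset_left (measure_firstRecord_zero h)
  · exact measure_firstRecord_inter ha hB

lemma measure_firstRecord_mem_inter (h : RecordsOccur ρ) (A : Set ℕ) {B : Set (ℕ → ℝ)}
    (hB : MeasurableSet B) :
    seqLaw ρ (firstRecord ⁻¹' A ∩ afterRecord ⁻¹' B) =
      seqLaw ρ (firstRecord ⁻¹' A) * seqLaw ρ B := by
  have hm : ∀ a, MeasurableSet {x : ℕ → ℝ | firstRecord x = a} := fun a =>
    measurable_firstRecord (measurableSet_singleton a)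
  have e : firstRecord ⁻¹' A = ⋃ a ∈ A, {x | firstRecord x = a} := by
    ext x
    simp
  have hd : A.PairwiseDisjoint (fun a => {x : ℕ → ℝ | firstRecord x = a}) := by
    intro a _ b _ hab
    refine Set.disjoint_left.2 fun x hx hy => hab ?_
    rw [← (show firstRecord x = a from hx), ← (show firstRecord x = b from hy)]
  have hd' : A.PairwiseDisjoint (fun a => {x : ℕ → ℝ | firstRecord x = a} ∩ afterRecord ⁻¹' B) :=
    hd.mono fun a => inter_subset_left
  rw [e, iUnion₂_inter, measure_biUnion (to_countable A) hd' fun a _ =>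
    (hm a).inter (measurable_afterRecord hB), measure_biUnion (to_countable A) hd fun a _ => hm a,
    ← ENNReal.tsum_mul_right]
  exact tsum_congr fun a => measure_firstRecord_inter' h a hB

lemma measurePreserving_afterRecord (h : RecordsOccur ρ) :
    MeasurePreserving afterRecord (seqLaw ρ) (seqLaw ρ) := by
  refine ⟨measurable_afterRecord, Measure.ext fun B hB => ?_⟩
  rw [Measure.map_apply measurable_afterRecord hB]
  have := measure_firstRecord_mem_inter h univ hB
  rwa [preimage_univ, univ_inter, measure_univ, one_mul] at this

lemma indepFun_firstRecord_afterRecord (h : RecordsOccur ρ) :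
    IndepFun firstRecord afterRecord (seqLaw ρ) := by
  rw [indepFun_iff_measure_inter_preimage_eq_mul]
  intro A B _ hB
  rw [measure_firstRecord_mem_inter h A hB,
    (measurePreserving_afterRecord h).measure_preimage hB.nullMeasurableSet]

lemma measurePreserving_iterate_afterRecord (h : RecordsOccur ρ) (i : ℕ) :
    MeasurePreserving (afterRecord^[i]) (seqLaw ρ) (seqLaw ρ) :=
  (measurePreserving_afterRecord h).iterate i

lemma ae_forall_iterate (h : RecordsOccur ρ) :
    ∀ᵐ x ∂(seqLaw ρ), ∀ i, ∃ n, 1 ≤ n ∧ HasRecord (afterRecord^[i] x) n :=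
  ae_all_iff.2 fun i => (measurePreserving_iterate_afterRecord h i).quasiMeasurePreserving.ae h

lemma mgf_recordTime (h : RecordsOccur ρ) (k : ℕ) (t : ℝ) :
    mgf (fun x => (recordTime k x : ℝ)) (seqLaw ρ) t =
      mgf (fun x => (firstRecord x : ℝ)) (seqLaw ρ) t ^ k := by
  induction k with
  | zero => simp [recordTime]
  | succ k ih =>
    have hmp := measurePreserving_afterRecord h
    have hm : Measurable (fun x => (recordTime k x : ℝ)) :=
      measurable_from_top.comp (measurable_recordTime k)
    have hf : Measurable (fun x => (firstRecord x : ℝ)) :=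
      measurable_from_top.comp measurable_firstRecord
    have hi : IndepFun (fun x => (firstRecord x : ℝ)) (fun x => (recordTime k (afterRecord x) : ℝ))
        (seqLaw ρ) :=
      (indepFun_firstRecord_afterRecord h).comp (φ := fun n : ℕ => (n : ℝ)) (ψ := fun x =>
        (recordTime k x : ℝ)) measurable_from_top hm
    have e : (fun x => (recordTime (k + 1) x : ℝ)) =
        (fun x => (firstRecord x : ℝ)) + fun x => (recordTime k (afterRecord x) : ℝ) := by
      funext x
      simp [recordTime]
    rw [e, hi.mgf_add' hf.aestronglyMeasurable
      (hm.comp measurable_afterRecord).aestronglyMeasurable, pow_succ', ← ih]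
    congr 1
    conv_rhs => rw [← hmp.map_eq]
    rw [mgf_map hmp.aemeasurable
      (Real.measurable_exp.comp (hm.const_mul t)).aestronglyMeasurable]
    rfl

/-- Lower bound for the extreme level `y = 1`: each of the first `k` record gaps may be equal to 1.
-/
lemma le_measure_recordTime_le (k : ℕ) :
    (seqLaw ρ).real {x | firstRecord x = 1} ^ k ≤ (seqLaw ρ).real {x | recordTime k x ≤ k} := by
  induction k with
  | zero => simp [recordTime]
  | succ k ih =>
    have hB : MeasurableSet {x | recordTime k x ≤ k} := measurable_recordTime k measurableSet_Iic
    have hs : {x | firstRecord x = 1} ∩ afterRecord ⁻¹' {x | recordTime k x ≤ k} ⊆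
        {x | recordTime (k + 1) x ≤ k + 1} := by
      rintro x ⟨h1, h2⟩
      simp only [mem_ofPred_eq, mem_preimage, recordTime] at *
      omega
    refine le_trans ?_ (measureReal_mono hs)
    rw [measureReal_def (s := _ ∩ _), measure_firstRecord_inter le_rfl hB, ENNReal.toReal_mul,
      pow_succ']
    exact mul_le_mul_of_nonneg_left ih measureReal_nonneg

lemma identDistrib_firstRecord (h : RecordsOccur ρ) (i : ℕ) :
    IdentDistrib (fun x => (firstRecord (afterRecord^[i] x) : ℝ))
      (fun x => (firstRecord x : ℝ)) (seqLaw ρ) (seqLaw ρ) := by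
  have hf : Measurable (fun x => (firstRecord x : ℝ)) :=
    measurable_from_top.comp measurable_firstRecord
  have hmp := measurePreserving_iterate_afterRecord h i
  refine ⟨(hf.comp hmp.measurable).aemeasurable, hf.aemeasurable, ?_⟩
  conv_rhs => rw [← hmp.map_eq]
  rw [Measure.map_map hf hmp.measurable]
  rfl

/-- `afterRecord^[i]` preserves the law, which reduces to `i = 0`, where the first gap is
independent of everything after it. The strong law needs only this pairwise independence. -/
lemma indepFun_firstRecord_of_lt (h : RecordsOccur ρ) {i j : ℕ} (hij : i < j) :
    IndepFun (fun x => (firstRecord (afterRecord^[i] x) : ℝ))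
      (fun x => (firstRecord (afterRecord^[j] x) : ℝ)) (seqLaw ρ) := by
  have hf : Measurable (fun x => (firstRecord x : ℝ)) :=
    measurable_from_top.comp measurable_firstRecord
  obtain ⟨m, rfl⟩ := Nat.exists_eq_add_of_lt hij
  have hmp := measurePreserving_iterate_afterRecord h i
  have hm : Measurable (fun x => (firstRecord (afterRecord^[m] x) : ℝ)) :=
    hf.comp (measurePreserving_iterate_afterRecord h m).measurable
  have h0 : IndepFun (fun x => (firstRecord x : ℝ))
      (fun x => (firstRecord (afterRecord^[m] (afterRecord x)) : ℝ)) (seqLaw ρ) :=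
    (indepFun_firstRecord_afterRecord h).comp (φ := fun n : ℕ => (n : ℝ))
      measurable_from_top hm
  rw [indepFun_iff_measure_inter_preimage_eq_mul] at h0 ⊢
  intro A B hA hB
  have hA' := hf hA
  have hB' : MeasurableSet
      ((fun x => (firstRecord (afterRecord^[m] (afterRecord x)) : ℝ)) ⁻¹' B) :=
    (hm.comp measurable_afterRecord) hB
  have := h0 A B hA hB
  rw [← hmp.measure_preimage (hA'.inter hB').nullMeasurableSet,
    ← hmp.measure_preimage hA'.nullMeasurableSet,
    ← hmp.measure_preimage hB'.nullMeasurableSet] at this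
  have e : ∀ x, afterRecord^[i + m + 1] x = afterRecord^[m] (afterRecord (afterRecord^[i] x)) := by
    intro x
    rw [← Function.iterate_succ_apply, ← Function.iterate_add_apply]
    congr 1
    omega
  simp only [e]
  exact this

/-! ### The Sparre Andersen identity -/

lemma measurableSet_nonneg_partialSum (n : ℕ) :
    MeasurableSet {x : ℕ → ℝ | 0 ≤ partialSum x n} :=
  measurableSet_le measurable_const (measurable_partialSum n)

lemma one_le_numRecords (x : ℕ → ℝ) (n : ℕ) : 1 ≤ numRecords x n := by
  classical
  rw [numRecords, Nat.one_le_iff_ne_zero, Finset.card_ne_zero]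
  exact ⟨0, by simp [hasRecord_zero]⟩

lemma numRecords_le (x : ℕ → ℝ) (n : ℕ) : numRecords x n ≤ n + 1 := by
  classical
  rw [numRecords]
  exact (Finset.card_filter_le _ _).trans (by simp)

lemma measurableSet_record_eq (k n : ℕ) :
    MeasurableSet {x : ℕ → ℝ | HasRecord x (n + 1) ∧ numRecords x n = k} :=
  (measurableSet_hasRecord (n + 1)).inter
    (measurable_numRecords n (measurableSet_singleton k))

-- Sorting the weight of `sum_rotation` by the number of records turns its expectation into the
-- probabilities that `n + 1` is the time of the `(k + 1)`-st positive record.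
open Classical in
lemma ite_hasRecord_eq_sum (x : ℕ → ℝ) (n : ℕ) :
    (if HasRecord x (n + 1) then (1 / (numRecords x n : ℝ)) else 0) =
      ∑ k ∈ Finset.range (n + 1), (1 / ((k : ℝ) + 1)) *
        {x : ℕ → ℝ | HasRecord x (n + 1) ∧ numRecords x n = k + 1}.indicator (fun _ => (1 : ℝ)) x := by
  split_ifs with h
  · have h1 := one_le_numRecords x n
    have h2 := numRecords_le x n
    rw [Finset.sum_eq_single (numRecords x n - 1)]
    · rw [indicator_of_mem (by exact ⟨h, by omega⟩)]
      push_cast [Nat.cast_sub h1]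
      simp
    · intro k _ hk
      rw [indicator_of_notMem, mul_zero]
      rintro ⟨-, h3⟩
      omega
    · intro h3
      rw [Finset.mem_range] at h3
      omega
  · symm
    refine Finset.sum_eq_zero fun k _ => ?_
    rw [indicator_of_notMem, mul_zero]
    exact fun h' => h h'.1

/-- Expectation of `sum_rotation`: rotations preserve the product law, so the `n + 1` terms on the
left have equal expectation. -/
lemma measure_nonneg_partialSum (n : ℕ) :
    (seqLaw ρ).real {x | 0 ≤ partialSum x (n + 1)} / ((n : ℝ) + 1) =
      ∑ k ∈ Finset.range (n + 1), (1 / ((k : ℝ) + 1)) *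
        (seqLaw ρ).real {x | HasRecord x (n + 1) ∧ numRecords x n = k + 1} := by
  classical
  set w : (ℕ → ℝ) → ℝ := fun x =>
    if HasRecord x (n + 1) then (1 / (numRecords x n : ℝ)) else 0 with hw
  have hwsum : w = fun x => ∑ k ∈ Finset.range (n + 1), (1 / ((k : ℝ) + 1)) *
      {x : ℕ → ℝ | HasRecord x (n + 1) ∧ numRecords x n = k + 1}.indicator
        (fun _ => (1 : ℝ)) x := funext fun x => ite_hasRecord_eq_sum x n
  have hterm : ∀ k ∈ Finset.range (n + 1), Integrable (fun x => (1 / ((k : ℝ) + 1)) *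
      {x : ℕ → ℝ | HasRecord x (n + 1) ∧ numRecords x n = k + 1}.indicator
        (fun _ => (1 : ℝ)) x) (seqLaw ρ) := fun k _ =>
    ((integrable_const _).indicator (measurableSet_record_eq _ _)).const_mul _
  have hwint : Integrable w (seqLaw ρ) := by
    rw [hwsum]
    exact integrable_finsetSum _ hterm
  have hval : ∫ x, w x ∂(seqLaw ρ) = ∑ k ∈ Finset.range (n + 1), (1 / ((k : ℝ) + 1)) *
        (seqLaw ρ).real {x | HasRecord x (n + 1) ∧ numRecords x n = k + 1} := by
    rw [hwsum, integral_finsetSum _ hterm]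
    refine Finset.sum_congr rfl fun k _ => ?_
    rw [integral_const_mul, integral_indicator_const _ (measurableSet_record_eq _ _), smul_eq_mul,
      mul_one]
  have hrot : ∀ v, MeasurePreserving (fun x : ℕ → ℝ => x ∘ rotation (n + 1) v)
      (seqLaw ρ) (seqLaw ρ) := fun v => measurePreserving_comp (rotation_injective _ _)
  have hsum : ∀ x, ∑ v ∈ Finset.range (n + 1), w (x ∘ rotation (n + 1) v) =
      {x : ℕ → ℝ | 0 ≤ partialSum x (n + 1)}.indicator (fun _ => (1 : ℝ)) x := by
    intro x
    rw [hw, sum_rotation, indicator_apply]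
    rfl
  have hI : ∫ x, ∑ v ∈ Finset.range (n + 1), w (x ∘ rotation (n + 1) v) ∂(seqLaw ρ) =
      (seqLaw ρ).real {x | 0 ≤ partialSum x (n + 1)} := by
    simp only [hsum]
    rw [integral_indicator_const _ (measurableSet_nonneg_partialSum _), smul_eq_mul, mul_one]
  have hcomp : ∀ v, ∫ x, w (x ∘ rotation (n + 1) v) ∂(seqLaw ρ) = ∫ x, w x ∂(seqLaw ρ) := by
    intro v
    conv_rhs => rw [← (hrot v).map_eq]
    rw [integral_map (hrot v).aemeasurable]
    rw [(hrot v).map_eq]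
    exact hwint.aestronglyMeasurable
  have hrotint : ∀ v, Integrable (fun x => w (x ∘ rotation (n + 1) v)) (seqLaw ρ) := fun v =>
    (hrot v).integrable_comp_of_integrable hwint
  rw [integral_finsetSum _ fun v _ => hrotint v] at hI
  simp only [hcomp, Finset.sum_const, Finset.card_range, nsmul_eq_mul] at hI
  rw [← hval, ← hI]
  push_cast
  field_simp

lemma recordTime_ae_eq (h : RecordsOccur ρ) (k n : ℕ) :
    (seqLaw ρ) {x | HasRecord x (n + 1) ∧ numRecords x n = k} =
      (seqLaw ρ) {x | recordTime k x = n + 1} := by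
  refine measure_congr ?_
  filter_upwards [ae_forall_iterate h] with x hx
  exact propext (recordTime_eq_iff hx n).symm

lemma one_le_recordTime_succ {x : ℕ → ℝ} (hx : ∃ n, 1 ≤ n ∧ HasRecord x n) (k : ℕ) :
    1 ≤ recordTime (k + 1) x :=
  (firstRecord_spec hx).1.trans (Nat.le_add_right _ _)

lemma integrable_exp_mul_natCast {Ω : Type*} [MeasurableSpace Ω] {μ : Measure Ω}
    [IsFiniteMeasure μ] {T : Ω → ℕ} (hT : Measurable T) {t : ℝ} (ht : t ≤ 0) :
    Integrable (fun ω => Real.exp (t * (T ω : ℝ))) μ := by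
  have hm : Measurable (fun ω => (T ω : ℝ)) := measurable_from_top.comp hT
  refine Integrable.of_bound (C := 1) (hm.const_mul t).exp.aestronglyMeasurable
    (ae_of_all _ fun ω => ?_)
  rw [Real.norm_eq_abs, Real.abs_exp, Real.exp_le_one_iff]
  exact mul_nonpos_of_nonpos_of_nonneg ht (Nat.cast_nonneg _)

lemma ofReal_mgf_natCast {Ω : Type*} [MeasurableSpace Ω] {μ : Measure Ω}
    [IsFiniteMeasure μ] {T : Ω → ℕ} (hT : Measurable T) {t : ℝ} (ht : t ≤ 0) :
    ENNReal.ofReal (mgf (fun ω => (T ω : ℝ)) μ t) =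
      ∑' n : ℕ, ENNReal.ofReal (Real.exp (t * n)) * μ {ω | T ω = n} := by
  rw [mgf, ofReal_integral_eq_lintegral_ofReal (integrable_exp_mul_natCast hT ht)
    (ae_of_all _ fun _ => (Real.exp_pos _).le),
    ← lintegral_map (f := fun n : ℕ => ENNReal.ofReal (Real.exp (t * n))) measurable_from_top hT,
    lintegral_countable']
  refine tsum_congr fun n => ?_
  rw [Measure.map_apply hT (measurableSet_singleton n)]
  rfl

lemma mgf_natCast_le_exp {Ω : Type*} [MeasurableSpace Ω] {μ : Measure Ω}
    [IsProbabilityMeasure μ] {T : Ω → ℕ} (hT : Measurable T) (h1 : ∀ᵐ ω ∂μ, 1 ≤ T ω)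
    {t : ℝ} (ht : t ≤ 0) :
    mgf (fun ω => (T ω : ℝ)) μ t ≤ Real.exp t := by
  have : mgf (fun ω => (T ω : ℝ)) μ t ≤ ∫ _, Real.exp t ∂μ := by
    refine integral_mono_ae (integrable_exp_mul_natCast hT ht) (integrable_const _) ?_
    filter_upwards [h1] with ω hω
    refine Real.exp_le_exp.2 ?_
    have : (1 : ℝ) ≤ T ω := by exact_mod_cast hω
    nlinarith
  simpa using this

lemma ae_one_le_firstRecord (h : RecordsOccur ρ) : ∀ᵐ x ∂(seqLaw ρ), 1 ≤ firstRecord x := by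
  filter_upwards [h] with x hx using (firstRecord_spec hx).1

/-- The Sparre Andersen identity. -/
lemma hasSum_nonneg_partialSum (h : RecordsOccur ρ) {t : ℝ} (ht : t < 0) :
    HasSum (fun n : ℕ => Real.exp t ^ (n + 1) *
        ((seqLaw ρ).real {x | 0 ≤ partialSum x (n + 1)} / ((n : ℝ) + 1)))
      (-Real.log (1 - mgf (fun x => (firstRecord x : ℝ)) (seqLaw ρ) t)) := by
  set F := mgf (fun x => (firstRecord x : ℝ)) (seqLaw ρ) t with hF
  have hF0 : 0 ≤ F := mgf_nonneg
  have hz1 : Real.exp t < 1 := Real.exp_lt_one_iff.2 ht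
  have hF1 : F < 1 :=
    (mgf_natCast_le_exp measurable_firstRecord (ae_one_le_firstRecord h) ht.le).trans_lt hz1
  have hlog := Real.hasSum_pow_div_log_of_abs_lt_one (x := F) (by rwa [abs_of_nonneg hF0])
  -- `F ^ (k + 1)` is the generating function of `recordTime (k + 1)`, expanded here over the values
  -- `n + 1`; the value 0 has probability zero.
  have hk : ∀ k : ℕ, ENNReal.ofReal (F ^ (k + 1) / (k + 1)) =
      ∑' n : ℕ, ENNReal.ofReal (Real.exp t ^ (n + 1) * ((1 / ((k : ℝ) + 1)) *
        (seqLaw ρ).real {x | recordTime (k + 1) x = n + 1})) := by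
    intro k
    rw [div_eq_inv_mul, ENNReal.ofReal_mul (by positivity), ← mgf_recordTime h,
      ofReal_mgf_natCast (measurable_recordTime _) ht.le, ← ENNReal.tsum_mul_left,
      tsum_eq_zero_add' ENNReal.summable]
    have h0 : seqLaw ρ {x | recordTime (k + 1) x = 0} = 0 := by
      refine measure_mono_null (t := {x | ¬ ∃ n, 1 ≤ n ∧ HasRecord x n}) ?_ h
      intro x hx hn
      have := one_le_recordTime_succ hn k
      rw [mem_ofPred_eq] at hx
      omega
    rw [h0, mul_zero, mul_zero, zero_add]
    refine tsum_congr fun n => ?_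
    rw [ENNReal.ofReal_mul (by positivity), ENNReal.ofReal_mul (by positivity), one_div,
      measureReal_def, ENNReal.ofReal_toReal (measure_ne_top _ _), mul_comm t, Real.exp_nat_mul]
    ring
  have hn : ∀ n : ℕ, ENNReal.ofReal (Real.exp t ^ (n + 1) *
        ((seqLaw ρ).real {x | 0 ≤ partialSum x (n + 1)} / ((n : ℝ) + 1))) =
      ∑' k : ℕ, ENNReal.ofReal (Real.exp t ^ (n + 1) * ((1 / ((k : ℝ) + 1)) *
        (seqLaw ρ).real {x | recordTime (k + 1) x = n + 1})) := by
    intro n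
    rw [measure_nonneg_partialSum, Finset.mul_sum,
      ENNReal.ofReal_sum_of_nonneg (fun _ _ => by positivity)]
    rw [tsum_eq_sum (s := Finset.range (n + 1))]
    · refine Finset.sum_congr rfl fun k _ => ?_
      rw [measureReal_def, recordTime_ae_eq h, measureReal_def]
    · intro k hk
      rw [measureReal_def, ← recordTime_ae_eq h]
      have : {x | HasRecord x (n + 1) ∧ numRecords x n = k + 1} = ∅ := by
        refine eq_empty_of_forall_notMem fun x hx => ?_
        have := numRecords_le x n
        rw [hx.2] at this
        rw [Finset.mem_range] at hk
        omega
      rw [this]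
      simp
  have hnonneg : ∀ n : ℕ, 0 ≤ Real.exp t ^ (n + 1) *
        ((seqLaw ρ).real {x | 0 ≤ partialSum x (n + 1)} / ((n : ℝ) + 1)) :=
    fun n => by positivity
  have hsummable : Summable (fun n : ℕ => Real.exp t ^ (n + 1) *
        ((seqLaw ρ).real {x | 0 ≤ partialSum x (n + 1)} / ((n : ℝ) + 1))) := by
    refine Summable.of_nonneg_of_le hnonneg (fun n => ?_)
      ((summable_geometric_of_lt_one (Real.exp_pos t).le hz1).comp_injective
        (add_left_injective 1))
    refine mul_le_of_le_one_right (by positivity) ?_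
    refine div_le_one_of_le₀ ?_ (by positivity)
    exact measureReal_le_one.trans (by linarith [(Nat.cast_nonneg n : (0 : ℝ) ≤ n)])
  have hpos : 0 ≤ -Real.log (1 - F) := by
    rw [neg_nonneg]
    exact Real.log_nonpos (by linarith) (by linarith)
  -- By `hn` and `hk` both sides are the same double series summed in the two orders; in `[0, ∞]`
  -- the exchange needs no summability.
  have key : ENNReal.ofReal (∑' n : ℕ, Real.exp t ^ (n + 1) *
        ((seqLaw ρ).real {x | 0 ≤ partialSum x (n + 1)} / ((n : ℝ) + 1))) =
      ENNReal.ofReal (-Real.log (1 - F)) := by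
    rw [ENNReal.ofReal_tsum_of_nonneg hnonneg hsummable, ← hlog.tsum_eq,
      ENNReal.ofReal_tsum_of_nonneg (fun n => by positivity) hlog.summable]
    simp only [hk, hn]
    exact ENNReal.tsum_comm
  rw [ENNReal.ofReal_eq_ofReal_iff (tsum_nonneg hnonneg) hpos] at key
  rw [← key]
  exact hsummable.hasSum

/-- Subtract the Sparre Andersen series from `∑ z^n / n = -log (1 - z)` with `z = exp t`. -/
lemma hasSum_neg_partialSum (h : RecordsOccur ρ) {t : ℝ} (ht : t < 0) :
    HasSum (fun n : ℕ => Real.exp t ^ (n + 1) *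
        ((seqLaw ρ).real {x | partialSum x (n + 1) < 0} / ((n : ℝ) + 1)))
      (Real.log ((1 - mgf (fun x => (firstRecord x : ℝ)) (seqLaw ρ) t) / (1 - Real.exp t))) := by
  have hz1 : Real.exp t < 1 := Real.exp_lt_one_iff.2 ht
  have hF1 : mgf (fun x => (firstRecord x : ℝ)) (seqLaw ρ) t < 1 :=
    (mgf_natCast_le_exp measurable_firstRecord (ae_one_le_firstRecord h) ht.le).trans_lt hz1
  have h1 := Real.hasSum_pow_div_log_of_abs_lt_one (x := Real.exp t)
    (by rwa [abs_of_pos (Real.exp_pos t)])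
  convert! h1.sub (hasSum_nonneg_partialSum h ht) using 1
  · funext n
    have : {x : ℕ → ℝ | partialSum x (n + 1) < 0} = {x | 0 ≤ partialSum x (n + 1)}ᶜ := by
      ext x
      simp
    rw [this, probReal_compl_eq_one_sub (measurableSet_nonneg_partialSum _)]
    ring
  · rw [Real.log_div (by linarith) (by linarith)]
    ring

/-! ### The mean of the first record time -/

/-- There is no record at `1, …, m`. -/
def NoRecordUpTo (x : ℕ → ℝ) (m : ℕ) : Prop := ∀ i, 1 ≤ i → i ≤ m → ¬ HasRecord x i

lemma measurableSet_noRecordUpTo (m : ℕ) : MeasurableSet {x : ℕ → ℝ | NoRecordUpTo x m} := by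
  simp only [NoRecordUpTo, ofPred_forall]
  exact MeasurableSet.iInter fun i => MeasurableSet.iInter fun _ => MeasurableSet.iInter fun _ =>
    (measurableSet_hasRecord i).compl

/-- The two events differ only on paths without positive record, where `firstRecord` has its default
value 0. -/
lemma measure_noRecordUpTo (h : RecordsOccur ρ) (m : ℕ) :
    seqLaw ρ {x | NoRecordUpTo x m} = seqLaw ρ {x | m < firstRecord x} := by
  refine measure_congr ?_
  filter_upwards [h] with x hx
  obtain ⟨h1, h2⟩ := firstRecord_spec hx
  refine propext ⟨fun H => ?_, fun H i hi him hr => ?_⟩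
  · exact not_le.1 fun hle => H _ h1 hle h2
  · exact absurd (firstRecord_le hi hr) (not_le.2 (lt_of_le_of_lt him H))

/-- Decomposition according to the last record up to time `N`. -/
lemma sum_lastRecord (N : ℕ) :
    ∑ j ∈ Finset.range (N + 1), seqLaw ρ {x | HasRecord x j} *
      seqLaw ρ {x | NoRecordUpTo x (N - j)} = 1 := by
  classical
  have hterm : ∀ j, seqLaw ρ {x | HasRecord x j} * seqLaw ρ {x | NoRecordUpTo x (N - j)} =
      seqLaw ρ ({x | HasRecord x j} ∩ shift j ⁻¹' {x | NoRecordUpTo x (N - j)}) := fun j =>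
    (measure_inter_shift (measurableSet_hasRecord j) (measurableSet_noRecordUpTo _)
      fun x y hxy hx => (hasRecord_congr hxy).1 hx).symm
  simp only [hterm]
  rw [← measure_biUnion_finset, ← measure_univ (μ := seqLaw ρ)]
  · congr 1
    refine eq_univ_of_forall fun x => ?_
    simp only [mem_iUnion]
    -- The last record up to `N` exists because 0 is a record.
    have hr := Nat.findGreatest_spec (P := HasRecord x) (Nat.zero_le N) (hasRecord_zero x)
    have hle := Nat.findGreatest_le (P := HasRecord x) N
    refine ⟨Nat.findGreatest (HasRecord x) N, Finset.mem_range.2 (by omega), hr, ?_⟩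
    intro i hi hiN hri
    rw [hasRecord_shift_iff hr] at hri
    exact Nat.findGreatest_is_greatest (P := HasRecord x) (n := N) (by omega) (by omega) hri
  · have hlt : ∀ i j : ℕ, i < j → j ≤ N →
        Disjoint ({x | HasRecord x i} ∩ shift i ⁻¹' {x | NoRecordUpTo x (N - i)})
          ({x | HasRecord x j} ∩ shift j ⁻¹' {x | NoRecordUpTo x (N - j)}) := by
      intro i j hij hj
      refine Set.disjoint_left.2 ?_
      rintro x ⟨h1, h2⟩ ⟨h3, -⟩
      refine h2 (j - i) (by omega) (by omega) ((hasRecord_shift_iff h1 _).2 ?_)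
      rw [Nat.add_sub_cancel' hij.le]
      exact h3
    intro i hi j hj hij
    have hi' := Finset.mem_range.1 (Finset.mem_coe.1 hi)
    have hj' := Finset.mem_range.1 (Finset.mem_coe.1 hj)
    rcases lt_or_gt_of_ne hij with hlt' | hlt'
    · exact hlt i j hlt' (by omega)
    · exact (hlt j i hlt' (by omega)).symm
  · intro j _
    exact (measurableSet_hasRecord j).inter (measurable_shift j (measurableSet_noRecordUpTo _))

/-- The injection of `ℕ` reversing `{0, …, n - 1}` and fixing the other integers. -/
def reversal (n i : ℕ) : ℕ := if i < n then n - 1 - i else i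

lemma reversal_injective (n : ℕ) : Function.Injective (reversal n) := by
  intro i j h
  unfold reversal at h
  split_ifs at h <;> omega

lemma partialSum_reversal (x : ℕ → ℝ) {n i : ℕ} (hi : i ≤ n) :
    partialSum (x ∘ reversal n) i = partialSum x n - partialSum x (n - i) := by
  induction i with
  | zero => simp [partialSum]
  | succ i ih =>
    have e : n - i = n - (i + 1) + 1 := by omega
    have h1 : partialSum x (n - i) = partialSum x (n - (i + 1)) + x (n - (i + 1)) := by
      rw [e, partialSum, Finset.sum_range_succ]
      rfl
    have h2 : partialSum (x ∘ reversal n) (i + 1) =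
        partialSum (x ∘ reversal n) i + x (n - (i + 1)) := by
      rw [partialSum, Finset.sum_range_succ, Function.comp, reversal, if_pos (by omega),
        show n - 1 - i = n - (i + 1) by omega]
      rfl
    rw [h2, ih (by omega), h1]
    ring

/-- The partial sums stay nonnegative up to time `n`. -/
def StaysNonneg (x : ℕ → ℝ) (n : ℕ) : Prop := ∀ i ≤ n, 0 ≤ partialSum x i

lemma measurableSet_staysNonneg (n : ℕ) : MeasurableSet {x : ℕ → ℝ | StaysNonneg x n} := by
  simp only [StaysNonneg, ofPred_forall]
  exact MeasurableSet.iInter fun i => MeasurableSet.iInter fun _ => measurableSet_nonneg_partialSum i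

/-- Duality: reversing the first `n` steps preserves the law and replaces the partial sums by `S_n -
S_{n - i}`, which are all nonnegative exactly when `n` is a record. -/
lemma measure_hasRecord (n : ℕ) :
    seqLaw ρ {x | HasRecord x n} = seqLaw ρ {x | StaysNonneg x n} := by
  rw [← (measurePreserving_comp (ρ := ρ) (reversal_injective n)).measure_preimage
    (measurableSet_staysNonneg n).nullMeasurableSet]
  congr 1
  ext x
  simp only [mem_ofPred_eq, mem_preimage]
  constructor
  · intro h i hi
    rw [partialSum_reversal x hi]
    linarith [h (n - i) (by omega)]
  · intro h k hk
    have := h (n - k) (by omega)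
    rw [partialSum_reversal x (by omega), show n - (n - k) = k by omega] at this
    linarith

lemma lintegral_natCast_eq_tsum {Ω : Type*} [MeasurableSpace Ω] {μ : Measure Ω} {T : Ω → ℕ}
    (hT : Measurable T) :
    ∫⁻ ω, (T ω : ℝ≥0∞) ∂μ = ∑' m : ℕ, μ {ω | m < T ω} := by
  have hm : ∀ m : ℕ, MeasurableSet {ω | m < T ω} := fun m => measurableSet_lt measurable_const hT
  have e : ∀ ω, (T ω : ℝ≥0∞) = ∑' m : ℕ, {ω | m < T ω}.indicator (fun _ => (1 : ℝ≥0∞)) ω := by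
    intro ω
    rw [tsum_eq_sum (s := Finset.range (T ω))]
    · rw [Finset.sum_congr rfl fun m hm => indicator_of_mem
        (by exact Finset.mem_range.1 hm) _]
      simp
    · intro m hm
      exact indicator_of_notMem (s := {ω | m < T ω}) (fun h => hm (Finset.mem_range.2 h)) _
  simp only [e]
  rw [lintegral_tsum fun m => (measurable_const.indicator (hm m)).aemeasurable]
  refine tsum_congr fun m => ?_
  rw [lintegral_indicator_const (hm m), one_mul]

lemma tendsto_measure_staysNonneg :
    Tendsto (fun n => seqLaw ρ {x | StaysNonneg x n}) atTop
      (𝓝 (seqLaw ρ {x | ∀ i, 0 ≤ partialSum x i})) := by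
  have e : {x : ℕ → ℝ | ∀ i, 0 ≤ partialSum x i} = ⋂ n, {x | StaysNonneg x n} := by
    ext x
    simp only [mem_ofPred_eq, mem_iInter]
    exact ⟨fun h n i _ => h i, fun h i => h i i le_rfl⟩
  rw [e]
  exact tendsto_measure_iInter_atTop (fun n => (measurableSet_staysNonneg n).nullMeasurableSet)
    (fun a b hab x hx i hi => hx i (hi.trans hab)) ⟨0, measure_ne_top _ _⟩

/-- With `p` the probability of staying nonnegative forever, `P(record at j) ≥ p` in
`sum_lastRecord`, so `p ∑_{m ≤ N} P(T > m) ≤ 1` and `E T ≤ 1 / p`. -/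
lemma lintegral_firstRecord_ne_top (h : RecordsOccur ρ)
    (hp : seqLaw ρ {x | ∀ i, 0 ≤ partialSum x i} ≠ 0) :
    ∫⁻ x, (firstRecord x : ℝ≥0∞) ∂(seqLaw ρ) ≠ ⊤ := by
  rw [lintegral_natCast_eq_tsum measurable_firstRecord]
  refine ne_top_of_le_ne_top (ENNReal.inv_ne_top.2 hp) ?_
  rw [ENNReal.tsum_eq_iSup_nat]
  refine iSup_le fun N => ?_
  rw [ENNReal.le_inv_iff_mul_le]
  refine le_trans ?_ (sum_lastRecord (ρ := ρ) N).le
  rw [Finset.sum_mul]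
  refine (Finset.sum_le_sum_of_subset (Finset.range_mono (Nat.le_succ N))).trans ?_
  rw [← Finset.sum_range_reflect]
  refine Finset.sum_le_sum fun j hj => ?_
  have hj' := Finset.mem_range.1 hj
  rw [show N + 1 - 1 - j = N - j by omega, measure_noRecordUpTo h,
    measure_hasRecord, mul_comm]
  exact mul_le_mul' (measure_mono fun x hx i _ => hx i) le_rfl

/-- If `E T` were finite, `P(T > m)` would be summable and would dominate the terms of
`sum_lastRecord`. Since `P(record at j) → 0`, the sum, always equal to 1, would tend to 0. -/
lemma lintegral_firstRecord_eq_top (h : RecordsOccur ρ)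
    (hp : seqLaw ρ {x | ∀ i, 0 ≤ partialSum x i} = 0) :
    ∫⁻ x, (firstRecord x : ℝ≥0∞) ∂(seqLaw ρ) = ⊤ := by
  by_contra hfin
  rw [lintegral_natCast_eq_tsum measurable_firstRecord] at hfin
  set r : ℕ → ℝ := fun m => (seqLaw ρ).real {x | m < firstRecord x} with hr
  set u : ℕ → ℝ := fun n => (seqLaw ρ).real {x | StaysNonneg x n} with hu
  have hsum : Summable r := ENNReal.summable_toReal hfin
  have hu0 : Tendsto u atTop (𝓝 0) := by
    have := tendsto_measure_staysNonneg (ρ := ρ)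
    rw [hp] at this
    exact (ENNReal.tendsto_toReal ENNReal.zero_ne_top).comp this
  have hlim : Tendsto (fun N => ∑' m, if m ≤ N then r m * u (N - m) else 0) atTop
      (𝓝 (∑' _ : ℕ, (0 : ℝ))) := by
    refine tendsto_tsum_of_dominated_convergence hsum (fun m => ?_) (Eventually.of_forall ?_)
    · have h1 : Tendsto (fun N => r m * u (N - m)) atTop (𝓝 0) := by
        simpa using (hu0.comp (tendsto_sub_atTop_nat m)).const_mul (r m)
      refine h1.congr' ?_
      filter_upwards [eventually_ge_atTop m] with N hN
      rw [if_pos hN]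
    · intro N m
      split_ifs
      · rw [Real.norm_of_nonneg (mul_nonneg measureReal_nonneg measureReal_nonneg)]
        exact mul_le_of_le_one_right measureReal_nonneg measureReal_le_one
      · rw [norm_zero]
        exact measureReal_nonneg
  have hone : ∀ N, ∑' m, (if m ≤ N then r m * u (N - m) else 0) = 1 := by
    intro N
    have := congrArg ENNReal.toReal (sum_lastRecord (ρ := ρ) N)
    rw [ENNReal.toReal_sum fun _ _ => ENNReal.mul_ne_top (measure_ne_top _ _) (measure_ne_top _ _),
      ENNReal.toReal_one, ← Finset.sum_range_reflect] at this
    rw [tsum_eq_sum (s := Finset.range (N + 1)), ← this]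
    · refine Finset.sum_congr rfl fun m hm => ?_
      have hm' := Finset.mem_range.1 hm
      rw [if_pos (by omega), ENNReal.toReal_mul, measure_hasRecord, measure_noRecordUpTo h, mul_comm,
        show N + 1 - 1 - m = N - m by omega, show N - (N - m) = m by omega]
      rfl
    · intro m hm
      rw [if_neg]
      rw [Finset.mem_range] at hm
      omega
  simp only [hone, tsum_zero] at hlim
  exact one_ne_zero (tendsto_nhds_unique tendsto_const_nhds hlim)

lemma integrable_firstRecord
    (hfin : ∫⁻ x, (firstRecord x : ℝ≥0∞) ∂(seqLaw ρ) ≠ ⊤) :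
    Integrable (fun x => (firstRecord x : ℝ)) (seqLaw ρ) := by
  refine ⟨(measurable_from_top.comp measurable_firstRecord).aestronglyMeasurable, ?_⟩
  rw [HasFiniteIntegral]
  convert lt_top_iff_ne_top.2 hfin using 3 with x
  rw [Real.enorm_natCast]

lemma natCast_geom_bounds {z : ℝ} (hz0 : 0 ≤ z) (hz1 : z < 1) (n : ℕ) :
    (1 - z ^ n) / (1 - z) = ∑ i ∈ Finset.range n, z ^ i ∧ (1 - z ^ n) / (1 - z) ≤ n := by
  have h : (1 - z ^ n) / (1 - z) = ∑ i ∈ Finset.range n, z ^ i := by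
    rw [geom_sum_eq hz1.ne, ← neg_div_neg_eq, neg_sub, neg_sub]
  refine ⟨h, h.le.trans ?_⟩
  calc ∑ i ∈ Finset.range n, z ^ i ≤ ∑ i ∈ Finset.range n, 1 :=
        Finset.sum_le_sum fun i _ => pow_le_one₀ hz0 hz1.le
    _ = n := by simp

lemma one_sub_mgf_div {t : ℝ} (ht : t < 0) :
    (1 - mgf (fun x => (firstRecord x : ℝ)) (seqLaw ρ) t) / (1 - Real.exp t) =
      ∫ x, (1 - Real.exp t ^ firstRecord x) / (1 - Real.exp t) ∂(seqLaw ρ) := by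
  have hint := integrable_exp_mul_natCast (μ := seqLaw ρ) measurable_firstRecord ht.le
  rw [integral_div, mgf]
  congr 1
  have e : ∀ x, Real.exp t ^ firstRecord x = Real.exp (t * (firstRecord x : ℝ)) := fun x => by
    rw [mul_comm, Real.exp_nat_mul]
  simp only [e]
  rw [integral_sub (integrable_const _) hint]
  simp

/-- The formula for the mean of the first record time. -/
lemma mean_firstRecord (h : RecordsOccur ρ)
    (hfin : ∫⁻ x, (firstRecord x : ℝ≥0∞) ∂(seqLaw ρ) ≠ ⊤) :
    Summable (fun k : ℕ => (seqLaw ρ).real {x | partialSum x (k + 1) < 0} / ((k : ℝ) + 1)) ∧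
    ∫ x, (firstRecord x : ℝ) ∂(seqLaw ρ) =
      Real.exp (∑' k : ℕ, (seqLaw ρ).real {x | partialSum x (k + 1) < 0} / ((k : ℝ) + 1)) := by
  set m := ∫ x, (firstRecord x : ℝ) ∂(seqLaw ρ) with hm
  set q : ℕ → ℝ := fun k => (seqLaw ρ).real {x | partialSum x (k + 1) < 0} / ((k : ℝ) + 1) with hq
  have hq0 : ∀ k, 0 ≤ q k := fun k => by positivity
  have hint := integrable_firstRecord hfin
  -- `Q z = (1 - E z^T) / (1 - z)` tends to the mean as `z ↑ 1`, being the expectation of a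
  -- geometric sum bounded by `T`; its logarithm is the power series with coefficients `q`.
  set Q : ℝ → ℝ := fun z => ∫ x, (1 - z ^ firstRecord x) / (1 - z) ∂(seqLaw ρ) with hQ
  have hmeas : ∀ z : ℝ, Measurable (fun x => (1 - z ^ firstRecord x) / (1 - z)) := fun z =>
    (measurable_from_top (f := fun n : ℕ => (1 - z ^ n) / (1 - z))).comp measurable_firstRecord
  have hbound : ∀ z : ℝ, 0 < z → z < 1 → ∀ n : ℕ, ‖(1 - z ^ n) / (1 - z)‖ ≤ n := by
    intro z hz0 hz1 n
    obtain ⟨h1, h2⟩ := natCast_geom_bounds hz0.le hz1 n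
    rw [Real.norm_of_nonneg]
    · exact h2
    · rw [h1]
      positivity
  have hev : ∀ᶠ z : ℝ in 𝓝[<] 1, 0 < z ∧ z < 1 := by
    filter_upwards [Ioo_mem_nhdsLT (zero_lt_one (α := ℝ))] with z hz using hz
  have hQlim : Tendsto Q (𝓝[<] 1) (𝓝 m) := by
    refine tendsto_integral_filter_of_dominated_convergence (fun x => (firstRecord x : ℝ))
      (Eventually.of_forall fun z => (hmeas z).aestronglyMeasurable) ?_ hint (ae_of_all _ fun x => ?_)
    · filter_upwards [hev] with z hz
      exact ae_of_all _ fun x => hbound z hz.1 hz.2 _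
    · have h1 : Tendsto (fun z : ℝ => ∑ i ∈ Finset.range (firstRecord x), z ^ i) (𝓝[<] 1)
          (𝓝 (∑ i ∈ Finset.range (firstRecord x), (1 : ℝ) ^ i)) := by
        refine Tendsto.mono_left ?_ nhdsWithin_le_nhds
        exact Continuous.tendsto (by fun_prop) 1
      simp only [one_pow, Finset.sum_const, Finset.card_range, nsmul_eq_mul, mul_one] at h1
      refine h1.congr' ?_
      filter_upwards [hev] with z hz
      exact (natCast_geom_bounds hz.1.le hz.2 _).1.symm
  have hQle : ∀ z, 0 < z → z < 1 → Q z ≤ m := by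
    intro z hz0 hz1
    refine integral_mono (hint.mono' (hmeas z).aestronglyMeasurable
      (ae_of_all _ fun x => hbound z hz0 hz1 _)) hint fun x => ?_
    exact (natCast_geom_bounds hz0.le hz1 _).2
  have hQ1 : ∀ z, 0 < z → z < 1 → 1 ≤ Q z := by
    intro z hz0 hz1
    have : ∫ _, (1 : ℝ) ∂(seqLaw ρ) ≤ Q z := by
      refine integral_mono_ae (integrable_const _) (hint.mono' (hmeas z).aestronglyMeasurable
        (ae_of_all _ fun x => hbound z hz0 hz1 _)) ?_
      filter_upwards [ae_one_le_firstRecord h] with x hx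
      rw [le_div_iff₀ (by linarith), one_mul]
      have : z ^ firstRecord x ≤ z := pow_le_of_le_one hz0.le hz1.le (by omega)
      linarith
    simpa using this
  have hm1 : 1 ≤ m := (hQ1 (1 / 2) (by norm_num) (by norm_num)).trans
    (hQle (1 / 2) (by norm_num) (by norm_num))
  have hsum : ∀ z, 0 < z → z < 1 → HasSum (fun n : ℕ => z ^ (n + 1) * q n) (Real.log (Q z)) := by
    intro z hz0 hz1
    have ht : Real.log z < 0 := Real.log_neg hz0 hz1
    have := hasSum_neg_partialSum h ht
    rwa [one_sub_mgf_div ht, Real.exp_log hz0] at this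
  -- Nonnegative coefficients and `Q ≤ m` bound the partial sums at `z = 1`; this gives the
  -- convergence that Abel's theorem requires.
  have hpartial : ∀ N, ∑ n ∈ Finset.range N, q n ≤ Real.log m := by
    intro N
    have h1 : Tendsto (fun z : ℝ => ∑ n ∈ Finset.range N, z ^ (n + 1) * q n) (𝓝[<] 1)
        (𝓝 (∑ n ∈ Finset.range N, (1 : ℝ) ^ (n + 1) * q n)) := by
      refine Tendsto.mono_left ?_ nhdsWithin_le_nhds
      exact Continuous.tendsto (by fun_prop) 1
    simp only [one_pow, one_mul] at h1
    refine le_of_tendsto h1 ?_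
    filter_upwards [hev] with z hz
    refine (sum_le_hasSum _ (fun n _ => ?_) (hsum z hz.1 hz.2)).trans
      (Real.log_le_log (by linarith [hQ1 z hz.1 hz.2]) (hQle z hz.1 hz.2))
    exact mul_nonneg (pow_nonneg hz.1.le _) (hq0 n)
  have hsq : Summable q := summable_of_sum_range_le hq0 hpartial
  refine ⟨hsq, ?_⟩
  have habel := Real.tendsto_tsum_powerSeries_nhdsWithin_lt hsq.hasSum.tendsto_sum_nat
  -- The factor `z` reconciles the exponents `n + 1` with those of a standard power series.
  have h2 : Tendsto (fun z : ℝ => z * ∑' n, q n * z ^ n) (𝓝[<] 1) (𝓝 (∑' n, q n)) := by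
    have h3 : Tendsto (fun z : ℝ => z) (𝓝[<] 1) (𝓝 1) := tendsto_nhdsWithin_of_tendsto_nhds tendsto_id
    simpa using h3.mul habel
  have h4 : Tendsto (fun z => Real.log (Q z)) (𝓝[<] 1) (𝓝 (∑' n, q n)) := by
    refine h2.congr' ?_
    filter_upwards [hev] with z hz
    rw [← (hsum z hz.1 hz.2).tsum_eq, ← tsum_mul_left]
    exact tsum_congr fun n => by ring
  have h5 := tendsto_nhds_unique h4 (hQlim.log (by linarith))
  rw [h5, Real.exp_log (by linarith)]

/-! ### Consequences of the behaviour at infinity -/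

/-- If all steps were almost surely negative, no positive time could be a record. This makes `P(T =
1)` positive, which bounds `Λ` from below. -/
lemma measure_nonneg_step_pos (h : RecordsOccur ρ) : 0 < (seqLaw ρ).real {x | 0 ≤ x 0} := by
  rw [measureReal_def, ENNReal.toReal_pos_iff]
  refine ⟨pos_iff_ne_zero.2 fun h0 => ?_, measure_lt_top _ _⟩
  have h1 : ∀ᵐ x ∂(seqLaw ρ), ∀ i, x i < 0 := by
    refine ae_all_iff.2 fun i => ?_
    have h2 : ∀ᵐ x ∂(seqLaw ρ), x 0 < 0 := by
      rw [ae_iff]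
      simpa using h0
    have h3 := (measurePreserving_shift (ρ := ρ) i).quasiMeasurePreserving.ae h2
    filter_upwards [h3] with x hx
    simpa [shift] using hx
  have h4 : ∀ᵐ _ ∂(seqLaw ρ), False := by
    filter_upwards [h, h1] with x hx hneg
    obtain ⟨n, hn, hr⟩ := hx
    have h5 := hr 0 (Nat.zero_le n)
    have h6 : partialSum x n < 0 :=
      Finset.sum_neg (fun i _ => hneg i) ⟨0, Finset.mem_range.2 hn⟩
    simp only [partialSum, Finset.range_zero, Finset.sum_empty] at h5 h6
    linarith
  exact h4.exists.elim fun _ hf => hf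

lemma firstRecord_eq_one_iff (x : ℕ → ℝ) : firstRecord x = 1 ↔ 0 ≤ x 0 := by
  rw [firstRecord_eq_iff le_rfl]
  constructor
  · rintro ⟨h, -⟩
    simpa [partialSum] using h 0 (Nat.zero_le 1)
  · intro h
    refine ⟨fun k hk => ?_, fun k h1 h2 => by omega⟩
    interval_cases k <;> simp [partialSum, h]

lemma exists_record_of_pos {x : ℕ → ℝ} {n : ℕ} (h : 0 < partialSum x n) :
    ∃ m, 1 ≤ m ∧ HasRecord x m := by
  obtain ⟨m, hm, hmax⟩ := Finset.exists_max_image (Finset.range (n + 1)) (partialSum x)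
    ⟨0, by simp⟩
  have hmn := hmax n (by simp)
  refine ⟨m, Nat.one_le_iff_ne_zero.2 ?_, fun k hk => hmax k ?_⟩
  · rintro rfl
    simp only [partialSum, Finset.range_zero, Finset.sum_empty] at hmn h
    linarith
  · rw [Finset.mem_range] at *
    omega

/-- A path tending to `+∞` attains its minimum at some `m`, and the path restarted at `m` stays
nonnegative. Were this event null, its preimages under the countably many shifts would be null too.
-/
lemma measure_staysNonneg_ne_zero_of_tendsto
    (h : ∀ᵐ x ∂(seqLaw ρ), Tendsto (partialSum x) atTop atTop) :
    seqLaw ρ {x | ∀ i, 0 ≤ partialSum x i} ≠ 0 := by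
  intro h0
  have h1 : ∀ᵐ x ∂(seqLaw ρ), ∀ n, ¬ ∀ i, 0 ≤ partialSum (shift n x) i := by
    refine ae_all_iff.2 fun n => ?_
    have h2 : ∀ᵐ x ∂(seqLaw ρ), ¬ ∀ i, 0 ≤ partialSum x i := by
      rw [ae_iff]
      simpa using h0
    exact (measurePreserving_shift (ρ := ρ) n).quasiMeasurePreserving.ae h2
  have h4 : ∀ᵐ _ ∂(seqLaw ρ), False := by
    filter_upwards [h, h1] with x hx hneg
    obtain ⟨N, hN⟩ := eventually_atTop.1 (hx.eventually_ge_atTop (partialSum x 0))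
    obtain ⟨m, hm, hmin⟩ := Finset.exists_min_image (Finset.range (N + 1)) (partialSum x)
      ⟨0, by simp⟩
    refine hneg m fun i => ?_
    rw [partialSum_shift, sub_nonneg]
    rcases lt_or_ge (m + i) (N + 1) with hi | hi
    · exact hmin _ (Finset.mem_range.2 hi)
    · exact (hmin 0 (by simp)).trans (hN _ (by omega))
  exact h4.exists.elim fun _ hf => hf

/-! ### The cumulant generating function of a positive integer valued variable -/

section Cumulant

variable {Ω : Type*} [MeasurableSpace Ω] {μ : Measure Ω} {T : Ω → ℕ}

lemma Iio_subset_interior_integrableExpSet [IsFiniteMeasure μ] (hT : Measurable T) :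
    Iio (0 : ℝ) ⊆ interior (integrableExpSet (fun ω => (T ω : ℝ)) μ) :=
  interior_maximal (fun _ ht => integrable_exp_mul_natCast hT (le_of_lt ht)) isOpen_Iio

lemma analyticOnNhd_cgf_natCast [IsFiniteMeasure μ] (hT : Measurable T) :
    AnalyticOnNhd ℝ (cgf (fun ω => (T ω : ℝ)) μ) (Iio 0) :=
  analyticOnNhd_cgf.mono (Iio_subset_interior_integrableExpSet hT)

variable [IsProbabilityMeasure μ]

lemma mgf_natCast_pos (hT : Measurable T) {t : ℝ} (ht : t ≤ 0) :
    0 < mgf (fun ω => (T ω : ℝ)) μ t :=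
  mgf_pos (integrable_exp_mul_natCast hT ht)

lemma cgf_natCast_le (hT : Measurable T) (h1 : ∀ᵐ ω ∂μ, 1 ≤ T ω) {t : ℝ} (ht : t ≤ 0) :
    cgf (fun ω => (T ω : ℝ)) μ t ≤ t := by
  rw [cgf, Real.log_le_iff_le_exp (mgf_natCast_pos hT ht)]
  exact mgf_natCast_le_exp hT h1 ht

lemma le_mgf_natCast (hT : Measurable T) {t : ℝ} (ht : t ≤ 0) :
    μ.real {ω | T ω = 1} * Real.exp t ≤ mgf (fun ω => (T ω : ℝ)) μ t := by
  have hm : MeasurableSet {ω | T ω = 1} := hT (measurableSet_singleton 1)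
  rw [mgf, ← smul_eq_mul, ← integral_indicator_const _ hm]
  refine integral_mono ((integrable_const _).indicator hm) (integrable_exp_mul_natCast hT ht) ?_
  intro ω
  by_cases h : T ω = 1
  · rw [indicator_of_mem (by exact h)]
    simp [h]
  · rw [indicator_of_notMem (by exact h)]
    exact (Real.exp_pos _).le

lemma le_cgf_natCast (hT : Measurable T) (hp : 0 < μ.real {ω | T ω = 1}) {t : ℝ} (ht : t ≤ 0) :
    t + Real.log (μ.real {ω | T ω = 1}) ≤ cgf (fun ω => (T ω : ℝ)) μ t := by
  have := Real.log_le_log (by positivity) (le_mgf_natCast hT ht)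
  rwa [Real.log_mul hp.ne' (Real.exp_pos t).ne', Real.log_exp, add_comm] at this

lemma mgf_natCast_le (hT : Measurable T) (h1 : ∀ᵐ ω ∂μ, 1 ≤ T ω) {t : ℝ} (ht : t ≤ 0) :
    mgf (fun ω => (T ω : ℝ)) μ t ≤ Real.exp t * (μ.real {ω | T ω = 1} + Real.exp t) := by
  have hm : MeasurableSet {ω | T ω = 1} := hT (measurableSet_singleton 1)
  have hi := (integrable_const (μ := μ) (Real.exp t)).indicator hm
  have : mgf (fun ω => (T ω : ℝ)) μ t ≤
      ∫ ω, ({ω | T ω = 1}.indicator (fun _ => Real.exp t) ω + Real.exp t * Real.exp t) ∂μ := by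
    refine integral_mono_ae (integrable_exp_mul_natCast hT ht)
      (hi.add (integrable_const _)) ?_
    filter_upwards [h1] with ω hω
    rcases hω.eq_or_lt with h | h
    · rw [indicator_of_mem (by exact h.symm), ← h]
      simp [mul_nonneg, Real.exp_nonneg]
    · rw [indicator_of_notMem (by exact fun h' => absurd h' h.ne'), zero_add, ← Real.exp_add]
      refine Real.exp_le_exp.2 ?_
      have : (2 : ℝ) ≤ T ω := by exact_mod_cast h
      nlinarith
  refine this.trans (le_of_eq ?_)
  rw [integral_add hi (integrable_const _), integral_indicator_const _ hm]
  simp only [smul_eq_mul, integral_const, probReal_univ, one_mul]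
  ring

/-- With `p = P(T = 1)`, separating `T = 1` from `T ≥ 2` places `t - Λ(t)` between `-log (p + exp
t)` and `-log p`; the supremum is approached as `t → -∞`. -/
lemma isLUB_one (hT : Measurable T) (h1 : ∀ᵐ ω ∂μ, 1 ≤ T ω)
    (hp : 0 < μ.real {ω | T ω = 1}) :
    IsLUB ((fun t => t * 1 - cgf (fun ω => (T ω : ℝ)) μ t) '' Iic 0)
      (-Real.log (μ.real {ω | T ω = 1})) := by
  constructor
  · rintro _ ⟨t, ht, rfl⟩
    have := le_cgf_natCast hT hp (mem_Iic.1 ht)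
    dsimp only
    linarith
  · intro b hb
    have h2 : Tendsto (fun t : ℝ => -Real.log (μ.real {ω | T ω = 1} + Real.exp t)) atBot
        (𝓝 (-Real.log (μ.real {ω | T ω = 1} + 0))) :=
      ((tendsto_const_nhds.add Real.tendsto_exp_atBot).log (by simpa using hp.ne')).neg
    rw [add_zero] at h2
    refine le_of_tendsto h2 ?_
    filter_upwards [eventually_le_atBot 0] with t ht
    refine le_trans ?_ (hb ⟨t, ht, rfl⟩)
    have h3 := Real.log_le_log (mgf_natCast_pos hT ht) (mgf_natCast_le hT h1 ht)
    rw [Real.log_mul (Real.exp_pos t).ne' (by positivity), Real.log_exp] at h3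
    dsimp only [cgf]
    linarith

/-- Analyticity covers only `t < 0`; continuity up to the endpoint 0 serves the compactness argument
below. -/
lemma continuousOn_cgf_natCast (hT : Measurable T) :
    ContinuousOn (cgf (fun ω => (T ω : ℝ)) μ) (Iic 0) := by
  have hc : ContinuousOn (mgf (fun ω => (T ω : ℝ)) μ) (Iic 0) := by
    refine continuousOn_of_dominated (bound := fun _ => (1 : ℝ))
      (fun t ht => (integrable_exp_mul_natCast hT ht).aestronglyMeasurable) (fun t ht => ?_)
      (integrable_const _) (ae_of_all _ fun ω => by fun_prop)
    refine ae_of_all _ fun ω => ?_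
    rw [Real.norm_eq_abs, Real.abs_exp, Real.exp_le_one_iff]
    exact mul_nonpos_of_nonpos_of_nonneg ht (Nat.cast_nonneg _)
  exact hc.log fun t ht => (mgf_natCast_pos hT ht).ne'

/-- The second derivative is the variance of `T` under the tilted law. If it vanished, `T` would be
almost surely constant, and the constant would be 1 because `P(T = 1) > 0`. -/
lemma iteratedDeriv_two_cgf_pos (hT : Measurable T) (hp : 0 < μ.real {ω | T ω = 1})
    (hnd : ¬ ∀ᵐ ω ∂μ, T ω = 1) {t : ℝ} (ht : t < 0) :
    0 < iteratedDeriv 2 (cgf (fun ω => (T ω : ℝ)) μ) t := by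
  have hmem := Iio_subset_interior_integrableExpSet (μ := μ) hT ht
  have hint := integrable_exp_mul_natCast (μ := μ) hT ht.le
  have := isProbabilityMeasure_tilted hint
  have hL2 := memLp_tilted_mul hmem 2
  rw [← variance_tilted_mul hmem]
  refine lt_of_le_of_ne (variance_nonneg _ _) fun h0 => hnd ?_
  have h2 : evariance (fun ω => (T ω : ℝ)) (μ.tilted fun ω => t * (T ω : ℝ)) = 0 := by
    rw [← hL2.ofReal_variance_eq, ← h0, ENNReal.ofReal_zero]
  rw [evariance_eq_zero_iff hL2.aestronglyMeasurable.aemeasurable] at h2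
  set c := ∫ ω, (T ω : ℝ) ∂(μ.tilted fun ω => t * (T ω : ℝ)) with hc
  have h3 : ∀ᵐ ω ∂μ, (T ω : ℝ) = c := absolutelyContinuous_tilted hint h2
  have h4 : ∃ᵐ ω ∂μ, T ω = 1 := by
    rw [frequently_ae_iff]
    intro h0
    rw [measureReal_def, h0] at hp
    simp at hp
  obtain ⟨ω, h5, h6⟩ := (h4.and_eventually h3).exists
  filter_upwards [h3] with ω' hω'
  rw [h5] at h6
  rw [← h6] at hω'
  exact_mod_cast hω'

lemma strictMonoOn_deriv_cgf (hT : Measurable T) (hp : 0 < μ.real {ω | T ω = 1})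
    (hnd : ¬ ∀ᵐ ω ∂μ, T ω = 1) :
    StrictMonoOn (deriv (cgf (fun ω => (T ω : ℝ)) μ)) (Iio 0) := by
  refine strictMonoOn_of_deriv_pos (convex_Iio 0)
    (analyticOnNhd_cgf_natCast hT).deriv.continuousOn fun t ht => ?_
  rw [interior_Iio] at ht
  have := iteratedDeriv_two_cgf_pos hT hp hnd ht
  rwa [iteratedDeriv_succ, iteratedDeriv_one] at this

lemma exists_lt_integral_min (hT : Measurable T) {y : ℝ}
    (hy : ENNReal.ofReal y < ∫⁻ ω, (T ω : ℝ≥0∞) ∂μ) :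
    ∃ N : ℕ, y < ∫ ω, ((min (T ω) N : ℕ) : ℝ) ∂μ := by
  have hmin : ∀ N : ℕ, Measurable (fun ω => min (T ω) N) := fun N => hT.min measurable_const
  have hsup : ∫⁻ ω, (T ω : ℝ≥0∞) ∂μ = ⨆ N : ℕ, ∫⁻ ω, ((min (T ω) N : ℕ) : ℝ≥0∞) ∂μ := by
    rw [← lintegral_iSup (f := fun N ω => ((min (T ω) N : ℕ) : ℝ≥0∞))
      (fun N => measurable_from_top.comp (hmin N))]
    · refine lintegral_congr fun ω => le_antisymm ?_ (iSup_le fun N => ?_)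
      · refine le_iSup_of_le (T ω) ?_
        simp
      · exact_mod_cast min_le_left _ _
    · intro a b hab ω
      dsimp only
      exact_mod_cast min_le_min_left _ hab
  rw [hsup, lt_iSup_iff] at hy
  obtain ⟨N, hN⟩ := hy
  refine ⟨N, ?_⟩
  have hint : Integrable (fun ω => ((min (T ω) N : ℕ) : ℝ)) μ := by
    refine Integrable.of_bound (C := N) (measurable_from_top.comp (hmin N)).aestronglyMeasurable
      (ae_of_all _ fun ω => ?_)
    rw [Real.norm_natCast]
    exact_mod_cast min_le_right _ _
  have h2 := ofReal_integral_eq_lintegral_ofReal hint (ae_of_all _ fun ω => Nat.cast_nonneg _)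
  simp only [ENNReal.ofReal_natCast] at h2
  rw [← h2] at hN
  exact (ENNReal.ofReal_lt_ofReal_iff' .. |>.1 hN).1

/-- `T` may have infinite mean, so it is truncated to a bounded `U ≤ T` with `E U > y`. The function
`t y - log E exp (t U)` vanishes at 0 with negative derivative there, hence is positive just to the
left; replacing `U` by `T` only increases it for `t < 0`. -/
lemma exists_pos_legendre (hT : Measurable T) {y : ℝ}
    (hy : ENNReal.ofReal y < ∫⁻ ω, (T ω : ℝ≥0∞) ∂μ) :
    ∃ t < 0, 0 < t * y - cgf (fun ω => (T ω : ℝ)) μ t := by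
  obtain ⟨N, hN⟩ := exists_lt_integral_min hT hy
  set U : Ω → ℝ := fun ω => ((min (T ω) N : ℕ) : ℝ) with hU
  have hUm : Measurable U := measurable_from_top.comp (hT.min measurable_const)
  have hset : integrableExpSet U μ = univ := by
    refine eq_univ_of_forall fun t => ?_
    refine integrable_exp_mul_of_mem_Icc (a := 0) (b := N) hUm.aemeasurable
      (ae_of_all _ fun ω => ⟨Nat.cast_nonneg _, ?_⟩)
    exact Nat.cast_le.2 (min_le_right _ _)
  have h0 : (0 : ℝ) ∈ interior (integrableExpSet U μ) := by simp [hset]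
  have hd : HasDerivAt (fun t => t * y - cgf U μ t) (y - ∫ ω, U ω ∂μ) 0 := by
    have h1 := (analyticAt_cgf h0).differentiableAt.hasDerivAt
    rw [deriv_cgf_zero h0, probReal_univ, div_one] at h1
    exact (by simpa using (hasDerivAt_id (0 : ℝ)).mul_const y : HasDerivAt (fun t => t * y) y 0).sub h1
  have hev : ∀ᶠ t in 𝓝[<] (0 : ℝ), slope (fun t => t * y - cgf U μ t) 0 t < 0 :=
    ((hasDerivAt_iff_tendsto_slope.1 hd).mono_left (nhdsWithin_mono 0 fun t ht =>
      ne_of_lt ht)).eventually_lt_const (by linarith)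
  obtain ⟨t, hslope, ht⟩ := (hev.and self_mem_nhdsWithin).exists
  refine ⟨t, ht, ?_⟩
  rw [slope_def_field, sub_zero, cgf_zero] at hslope
  simp only [zero_mul, sub_zero] at hslope
  have ht : t < 0 := ht
  have h2 : 0 < t * y - cgf U μ t := by
    by_contra hcon
    exact absurd (div_nonneg_of_nonpos (not_lt.1 hcon) ht.le) (not_le.2 hslope)
  have hiT := integrable_exp_mul_natCast (μ := μ) hT ht.le
  have h3 : mgf (fun ω => (T ω : ℝ)) μ t ≤ mgf U μ t := by
    refine integral_mono hiT (by have := hset ▸ mem_univ t; exact this) fun ω => ?_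
    refine Real.exp_le_exp.2 (mul_le_mul_of_nonpos_left ?_ ht.le)
    exact Nat.cast_le.2 (min_le_left _ _)
  have h4 := Real.log_le_log (mgf_pos hiT) h3
  rw [cgf] at h2 ⊢
  linarith

lemma not_ae_eq_one {y : ℝ} (h1 : 1 < y) (hy : ENNReal.ofReal y < ∫⁻ ω, (T ω : ℝ≥0∞) ∂μ) :
    ¬ ∀ᵐ ω ∂μ, T ω = 1 := by
  intro h
  have : ∫⁻ ω, (T ω : ℝ≥0∞) ∂μ = ∫⁻ _, 1 ∂μ := lintegral_congr_ae (by
    filter_upwards [h] with ω hω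
    simp [hω])
  rw [this, lintegral_one, measure_univ, ENNReal.ofReal_lt_one] at hy
  linarith

/-- The supremum in the Legendre transform is attained at a critical point. -/
lemma exists_deriv_cgf_eq (hT : Measurable T) (hp : 0 < μ.real {ω | T ω = 1}) {y : ℝ}
    (h1 : 1 < y) (hy : ENNReal.ofReal y < ∫⁻ ω, (T ω : ℝ≥0∞) ∂μ) :
    ∃ t < 0, deriv (cgf (fun ω => (T ω : ℝ)) μ) t = y ∧
      ∀ s ≤ 0, s * y - cgf (fun ω => (T ω : ℝ)) μ s ≤ t * y - cgf (fun ω => (T ω : ℝ)) μ t := by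
  set Λ := cgf (fun ω => (T ω : ℝ)) μ with hΛ
  set p := μ.real {ω | T ω = 1} with hpdef
  obtain ⟨t₀, ht₀, hpos⟩ := exists_pos_legendre hT hy
  -- Since `Λ(s) ≥ s + log p`, one has `s y - Λ(s) ≤ s (y - 1) - log p ≤ 0` below this threshold.
  -- The maximum over `[L, 0]` is positive, as `t₀` belongs to it, so it is global and not attained
  -- at 0.
  set L := min t₀ (Real.log p / (y - 1)) with hL
  have hL0 : L < 0 := (min_le_left _ _).trans_lt ht₀
  have hsmall : ∀ s ≤ L, s * y - Λ s ≤ 0 := by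
    intro s hs
    have h2 := le_cgf_natCast hT hp (hs.trans hL0.le)
    have h3 := hs.trans (min_le_right _ _)
    rw [le_div_iff₀ (by linarith)] at h3
    linarith
  have hcont : ContinuousOn (fun s => s * y - Λ s) (Icc L 0) :=
    (continuousOn_id.mul continuousOn_const).sub
      ((continuousOn_cgf_natCast hT).mono Icc_subset_Iic_self)
  obtain ⟨t, htmem, hmax⟩ := isCompact_Icc.exists_isMaxOn (nonempty_Icc.2 hL0.le) hcont
  have hval : 0 < t * y - Λ t := hpos.trans_le (hmax ⟨min_le_left _ _, ht₀.le⟩)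
  have hglob : ∀ s ≤ 0, s * y - Λ s ≤ t * y - Λ t := by
    intro s hs
    rcases le_total s L with h | h
    · exact (hsmall s h).trans hval.le
    · exact hmax ⟨h, hs⟩
  have ht : t < 0 := by
    refine lt_of_le_of_ne htmem.2 ?_
    rintro rfl
    rw [hΛ, cgf_zero] at hval
    linarith
  refine ⟨t, ht, ?_, hglob⟩
  have hloc : IsLocalMax (fun s => s * y - Λ s) t := by
    filter_upwards [Iio_mem_nhds ht] with s hs using hglob s (le_of_lt hs)
  have hd := (hasDerivAt_id t).mul_const y |>.sub
    ((analyticOnNhd_cgf_natCast (μ := μ) hT) t ht).differentiableAt.hasDerivAt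
  have := hloc.hasDerivAt_eq_zero hd
  linarith

end Cumulant

/-! ### Lower large deviations -/

section LargeDeviations

variable {Ω : Type*} [MeasurableSpace Ω] {μ : Measure Ω} [IsProbabilityMeasure μ]

/-- The strict inequalities make both tail terms of `mgf_natCast_le_window` exponentially smaller
than the generating function at `a`. -/
lemma exists_slope_bounds {Λ : ℝ → ℝ} {d a δ : ℝ} (hΛ : HasDerivAt Λ d a) (ha : a < 0)
    (hδ : 0 < δ) :
    ∃ s > 0, a + s < 0 ∧ Λ (a + s) - Λ a < s * (d + δ) ∧ Λ (a - s) - Λ a < -(s * (d - δ)) := by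
  have h := (hasDerivAt_iff_isLittleO_nhds_zero.1 hΛ).def (half_pos hδ)
  have hneg : Tendsto (fun s : ℝ => -s) (𝓝 0) (𝓝 0) := by simpa using (continuous_neg.tendsto (0 : ℝ))
  have h2 := hneg.eventually h
  have h3 : ∀ᶠ s : ℝ in 𝓝[>] 0, s < -a :=
    nhdsWithin_le_nhds (Iio_mem_nhds (by linarith))
  obtain ⟨s, ⟨⟨hs1, hs2⟩, hs3⟩, hs0⟩ :=
    ((((h.and h2).filter_mono nhdsWithin_le_nhds).and h3).and self_mem_nhdsWithin).exists
  have hs0 : 0 < s := hs0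
  rw [smul_eq_mul, norm_neg, Real.norm_of_nonneg hs0.le, Real.norm_eq_abs, abs_le] at hs2
  rw [smul_eq_mul, Real.norm_of_nonneg hs0.le, Real.norm_eq_abs, abs_le] at hs1
  have hsd := mul_pos hs0 hδ
  rw [← sub_eq_add_neg] at hs2
  exact ⟨s, hs0, by linarith, by linarith [hs1.2], by linarith [hs2.2]⟩

/-- Stands in for an explicit change of measure: `exp (a τ)` is at most `exp (a b)` on the window `b
≤ τ ≤ c`, while Chernoff factors with parameter `s` control it below `b` and above `c`. -/
lemma mgf_natCast_le_window {τ : Ω → ℕ} (hτ : Measurable τ) {a s b c r : ℝ} (ha : a < 0)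
    (hs : 0 < s) (has : a + s < 0) (hcr : c ≤ r) :
    mgf (fun ω => (τ ω : ℝ)) μ a ≤ Real.exp (a * b) * μ.real {ω | (τ ω : ℝ) ≤ r} +
      Real.exp (-s * c) * mgf (fun ω => (τ ω : ℝ)) μ (a + s) +
      Real.exp (s * b) * mgf (fun ω => (τ ω : ℝ)) μ (a - s) := by
  have hm : MeasurableSet {ω | (τ ω : ℝ) ≤ r} :=
    measurableSet_le (measurable_from_top.comp hτ) measurable_const
  have hi1 := (integrable_const (μ := μ) (1 : ℝ)).indicator hm |>.const_mul (Real.exp (a * b))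
  have hi2 := (integrable_exp_mul_natCast (μ := μ) hτ has.le).const_mul (Real.exp (-s * c))
  have hi3 := (integrable_exp_mul_natCast (μ := μ) hτ (by linarith : a - s ≤ 0)).const_mul
    (Real.exp (s * b))
  have key : mgf (fun ω => (τ ω : ℝ)) μ a ≤
      ∫ ω, (Real.exp (a * b) * {ω | (τ ω : ℝ) ≤ r}.indicator (fun _ => (1 : ℝ)) ω +
        Real.exp (-s * c) * Real.exp ((a + s) * τ ω) +
        Real.exp (s * b) * Real.exp ((a - s) * τ ω)) ∂μ := by
    refine integral_mono (integrable_exp_mul_natCast hτ ha.le) ((hi1.add hi2).add hi3) fun ω => ?_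
    have hind : 0 ≤ Real.exp (a * b) * {ω | (τ ω : ℝ) ≤ r}.indicator (fun _ => (1 : ℝ)) ω :=
      mul_nonneg (Real.exp_pos _).le (indicator_nonneg (fun _ _ => zero_le_one) _)
    have he2 : 0 < Real.exp (-s * c) * Real.exp ((a + s) * τ ω) := by positivity
    have he3 : 0 < Real.exp (s * b) * Real.exp ((a - s) * τ ω) := by positivity
    dsimp only
    rcases lt_or_ge (τ ω : ℝ) b with h1 | h1
    · have : Real.exp (a * τ ω) ≤ Real.exp (s * b) * Real.exp ((a - s) * τ ω) := by
        rw [← Real.exp_add]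
        exact Real.exp_le_exp.2 (by nlinarith)
      linarith
    rcases lt_or_ge c (τ ω : ℝ) with h2 | h2
    · have : Real.exp (a * τ ω) ≤ Real.exp (-s * c) * Real.exp ((a + s) * τ ω) := by
        rw [← Real.exp_add]
        exact Real.exp_le_exp.2 (by nlinarith)
      linarith
    · rw [indicator_of_mem (by exact h2.trans hcr), mul_one]
      have : Real.exp (a * τ ω) ≤ Real.exp (a * b) := Real.exp_le_exp.2 (by nlinarith)
      linarith
  refine key.trans (le_of_eq ?_)
  refine (integral_add (hi1.add hi2) hi3).trans ?_
  refine congrArg₂ (· + ·) ((integral_add hi1 hi2).trans ?_) (integral_const_mul _ _)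
  rw [integral_const_mul, integral_const_mul, integral_indicator_const _ hm]
  simp [mgf]

variable {T : Ω → ℕ} {τ : ℕ → Ω → ℕ}

lemma mgf_eq_exp_cgf (hT : Measurable T)
    (hmgf : ∀ k t, mgf (fun ω => (τ k ω : ℝ)) μ t = mgf (fun ω => (T ω : ℝ)) μ t ^ k)
    (k : ℕ) {t : ℝ} (ht : t ≤ 0) :
    mgf (fun ω => (τ k ω : ℝ)) μ t = Real.exp (k * cgf (fun ω => (T ω : ℝ)) μ t) := by
  rw [hmgf, Real.exp_nat_mul, cgf, Real.exp_log (mgf_natCast_pos hT ht)]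

lemma eventually_exp_natCast_mul_le {c : ℝ} (hc : c < 0) {e : ℝ} (he : 0 < e) :
    ∀ᶠ k : ℕ in atTop, Real.exp (k * c) ≤ e := by
  have h1 : Tendsto (fun k : ℕ => (k : ℝ) * c) atTop atBot :=
    tendsto_natCast_atTop_atTop.atTop_mul_const_of_neg hc
  exact (Real.tendsto_exp_atBot.comp h1).eventually_le_const he

/-- Under the tilt by `a`, `τ k` concentrates in the window of radius `k δ` around `k Λ'(a)`, which
lies below `k x`. -/
lemma le_measure_window (hT : Measurable T) (hτ : ∀ k, Measurable (τ k))
    (hmgf : ∀ k t, mgf (fun ω => (τ k ω : ℝ)) μ t = mgf (fun ω => (T ω : ℝ)) μ t ^ k)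
    {a δ x : ℝ} (ha : a < 0) (hδ : 0 < δ)
    (hx : deriv (cgf (fun ω => (T ω : ℝ)) μ) a + δ ≤ x) :
    ∀ᶠ k : ℕ in atTop, Real.exp (k * (cgf (fun ω => (T ω : ℝ)) μ a -
        a * deriv (cgf (fun ω => (T ω : ℝ)) μ) a + a * δ - δ)) ≤
      μ.real {ω | (τ k ω : ℝ) ≤ k * x} := by
  set Λ := cgf (fun ω => (T ω : ℝ)) μ with hΛ
  set d := deriv Λ a with hd
  have hder : HasDerivAt Λ d a :=
    (analyticOnNhd_cgf_natCast (μ := μ) hT a ha).differentiableAt.hasDerivAt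
  obtain ⟨s, hs, has, h1, h2⟩ := exists_slope_bounds hder ha hδ
  -- Each tail takes at most a quarter of `exp (k Λ(a))`, leaving half for the window; the factor
  -- `exp (-k δ)` absorbs this `1 / 2`.
  filter_upwards [eventually_exp_natCast_mul_le (sub_neg.2 h1) (by norm_num : (0 : ℝ) < 1 / 4),
    eventually_exp_natCast_mul_le (sub_neg.2 h2) (by norm_num : (0 : ℝ) < 1 / 4),
    eventually_exp_natCast_mul_le (neg_lt_zero.2 hδ) (by norm_num : (0 : ℝ) < 1 / 2)]
    with k hk1 hk2 hk3
  have hkx : (k : ℝ) * (d + δ) ≤ k * x := mul_le_mul_of_nonneg_left hx (Nat.cast_nonneg k)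
  have key := mgf_natCast_le_window (μ := μ) (hτ k) (b := k * (d - δ)) ha hs has hkx
  rw [mgf_eq_exp_cgf hT hmgf k ha.le, mgf_eq_exp_cgf hT hmgf k has.le,
    mgf_eq_exp_cgf hT hmgf k (by linarith : a - s ≤ 0), ← Real.exp_add, ← Real.exp_add] at key
  set P := μ.real {ω | (τ k ω : ℝ) ≤ k * x} with hP
  have e1 : -s * (k * (d + δ)) + k * Λ (a + s) =
      k * Λ a + k * (Λ (a + s) - Λ a - s * (d + δ)) := by ring
  have e2 : s * (k * (d - δ)) + k * Λ (a - s) =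
      k * Λ a + k * (Λ (a - s) - Λ a - -(s * (d - δ))) := by ring
  rw [e1, e2, Real.exp_add, Real.exp_add] at key
  have hE := Real.exp_pos (k * Λ a)
  have key2 : Real.exp (k * Λ a) * (1 / 2) ≤ Real.exp (a * (k * (d - δ))) * P := by
    nlinarith
  have e3 : (k : ℝ) * (Λ a - a * d + a * δ - δ) =
      -(a * (k * (d - δ))) + (k * Λ a + k * -δ) := by ring
  rw [e3, Real.exp_add, Real.exp_add]
  calc Real.exp (-(a * (k * (d - δ)))) * (Real.exp (k * Λ a) * Real.exp (k * -δ))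
      ≤ Real.exp (-(a * (k * (d - δ)))) * (Real.exp (k * Λ a) * (1 / 2)) := by gcongr
    _ ≤ Real.exp (-(a * (k * (d - δ)))) * (Real.exp (a * (k * (d - δ))) * P) := by gcongr
    _ = P := by rw [← mul_assoc, ← Real.exp_add]; simp

/-- The lower bound in Cramér's theorem for the lower tail. -/
lemma le_measure_lowerTail (hT : Measurable T) (hτ : ∀ k, Measurable (τ k))
    (hmgf : ∀ k t, mgf (fun ω => (τ k ω : ℝ)) μ t = mgf (fun ω => (T ω : ℝ)) μ t ^ k)
    (hmono : StrictMonoOn (deriv (cgf (fun ω => (T ω : ℝ)) μ)) (Iio 0))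
    {t x : ℝ} (ht : t < 0) (hx : deriv (cgf (fun ω => (T ω : ℝ)) μ) t = x) {ε : ℝ} (hε : 0 < ε) :
    ∀ᶠ k : ℕ in atTop,
      Real.exp (k * (-(t * x - cgf (fun ω => (T ω : ℝ)) μ t) - ε)) ≤
        μ.real {ω | (τ k ω : ℝ) ≤ k * x} := by
  set Λ := cgf (fun ω => (T ω : ℝ)) μ with hΛ
  have han := analyticOnNhd_cgf_natCast (μ := μ) hT
  have hcont : ContinuousAt (fun a => Λ a - a * deriv Λ a) t :=
    (han t ht).continuousAt.sub (continuousAt_id.mul (han.deriv t ht).continuousAt)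
  -- Tilting by `t` itself would centre the window at `k x`, so that part of it would exceed `k x`.
  -- A slightly smaller `a` has `Λ'(a) < x` at an arbitrarily small cost in the exponent.
  have hev : ∀ᶠ a in 𝓝[<] t, Λ t - t * deriv Λ t - ε / 2 < Λ a - a * deriv Λ a :=
    (hcont.eventually (lt_mem_nhds (by simpa using hε))).filter_mono nhdsWithin_le_nhds
  obtain ⟨a, ha1, ha2⟩ := (hev.and self_mem_nhdsWithin).exists
  have hat : a < t := ha2
  have ha : a < 0 := hat.trans ht
  have hda : deriv Λ a < x := hx ▸ hmono ha ht hat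
  -- The first bound keeps the window below `k x`, the second keeps the loss `δ (1 - a)` below `ε /
  -- 2`.
  set δ := min (x - deriv Λ a) (ε / 2 / (1 - a)) with hδ
  have hδ0 : 0 < δ := lt_min (by linarith) (by apply div_pos <;> linarith)
  have hδ1 : deriv Λ a + δ ≤ x := by linarith [min_le_left (x - deriv Λ a) (ε / 2 / (1 - a))]
  have hδ2 : δ * (1 - a) ≤ ε / 2 := by
    rw [← le_div_iff₀ (by linarith)]
    exact min_le_right _ _
  filter_upwards [le_measure_window hT hτ hmgf ha hδ0 hδ1] with k hk
  refine le_trans (Real.exp_le_exp.2 (mul_le_mul_of_nonneg_left ?_ (Nat.cast_nonneg k))) hk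
  rw [hx] at ha1
  linarith

/-- The upper bound is Chernoff's inequality. The lower bound is left as the hypothesis `hlow`,
because its proof differs between `y < 1` and `y = 1`. -/
lemma tendsto_log_measure_lowerTail (hT : Measurable T) (h1 : ∀ᵐ ω ∂μ, 1 ≤ T ω)
    (hmgf : ∀ k t, mgf (fun ω => (τ k ω : ℝ)) μ t = mgf (fun ω => (T ω : ℝ)) μ t ^ k)
    (hτ : ∀ k, Measurable (τ k)) {y L : ℝ} (hy0 : 0 < y) (hy1 : y ≤ 1)
    (hL : IsLUB ((fun t => t * (1 / y) - cgf (fun ω => (T ω : ℝ)) μ t) '' Iic 0) L)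
    (hlow : ∀ ε > 0, ∀ᶠ k : ℕ in atTop,
      Real.exp (k * (-L - ε)) ≤ μ.real {ω | (τ k ω : ℝ) ≤ k * (1 / y)}) :
    (∀ᶠ n : ℕ in atTop, 0 < μ.real {ω | τ (⌈(n : ℝ) * y⌉₊ - 1) ω ≤ n}) ∧
    Tendsto (fun n : ℕ => 1 / (n : ℝ) * Real.log (μ.real {ω | τ (⌈(n : ℝ) * y⌉₊ - 1) ω ≤ n})) atTop
      (𝓝 (-(y * L))) := by
  set Λ := cgf (fun ω => (T ω : ℝ)) μ with hΛ
  set κ : ℕ → ℕ := fun n => ⌈(n : ℝ) * y⌉₊ - 1 with hκ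
  set P : ℕ → ℝ := fun n => μ.real {ω | τ (κ n) ω ≤ n} with hP
  have hL0 : 0 ≤ L := by
    have := hL.1 ⟨0, mem_Iic.2 le_rfl, rfl⟩
    simpa [hΛ] using this
  have hκ1 : ∀ n : ℕ, (n : ℝ) * y - 1 ≤ κ n := by
    intro n
    have h2 := Nat.le_ceil ((n : ℝ) * y)
    have h3 : ⌈(n : ℝ) * y⌉₊ ≤ κ n + 1 := by
      simp only [hκ]
      omega
    have h4 : (⌈(n : ℝ) * y⌉₊ : ℝ) ≤ κ n + 1 := by exact_mod_cast h3
    linarith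
  have hκ2 : ∀ n : ℕ, (κ n : ℝ) ≤ n * y := by
    intro n
    rcases Nat.eq_zero_or_pos ⌈(n : ℝ) * y⌉₊ with h0 | h0
    · simp only [hκ, h0, Nat.zero_sub, Nat.cast_zero]
      positivity
    · have h2 := Nat.ceil_lt_add_one (by positivity : 0 ≤ (n : ℝ) * y)
      simp only [hκ]
      rw [Nat.cast_sub h0, Nat.cast_one]
      linarith
  have hκtop : Tendsto κ atTop atTop := by
    rw [← tendsto_natCast_atTop_iff (R := ℝ)]
    refine tendsto_atTop_mono hκ1 ?_
    exact tendsto_atTop_add_const_right _ _ (tendsto_natCast_atTop_atTop.atTop_mul_const hy0)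
  have hlow' : ∀ ε > 0, ∀ᶠ n : ℕ in atTop, Real.exp (κ n * (-L - ε)) ≤ P n := by
    intro ε hε
    filter_upwards [hκtop.eventually (hlow ε hε)] with n hn
    refine hn.trans (measureReal_mono fun ω hω => ?_)
    have h2 : (τ (κ n) ω : ℝ) ≤ κ n * (1 / y) := hω
    have h3 : (κ n : ℝ) * (1 / y) ≤ n := by
      rw [mul_one_div, div_le_iff₀ hy0]
      exact hκ2 n
    have h4 : (τ (κ n) ω : ℝ) ≤ n := h2.trans h3
    exact_mod_cast h4
  have hpos : ∀ᶠ n : ℕ in atTop, 0 < P n := by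
    filter_upwards [hlow' 1 one_pos] with n hn using (Real.exp_pos _).trans_le hn
  refine ⟨hpos, ?_⟩
  have hup : ∀ s ≤ 0, ∀ n : ℕ, P n ≤ Real.exp (-s * n + κ n * Λ s) := by
    intro s hs n
    have h2 := measure_le_le_exp_mul_mgf (μ := μ) (X := fun ω => (τ (κ n) ω : ℝ)) (n : ℝ) hs
      (integrable_exp_mul_natCast (hτ _) hs)
    rw [mgf_eq_exp_cgf hT hmgf _ hs, ← Real.exp_add] at h2
    simpa only [Nat.cast_le] using h2
  rw [Metric.tendsto_nhds]
  intro ε hε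
  -- A nearly optimal parameter suffices, so the supremum need not be attained.
  obtain ⟨_, ⟨s, hs, rfl⟩, hs2⟩ := (lt_isLUB_iff hL).1 (show L - ε / 4 < L by linarith)
  have hs : s ≤ 0 := hs
  have hΛs : Λ s ≤ 0 := (cgf_natCast_le hT h1 hs).trans hs
  have hsmall : ∀ᶠ n : ℕ in atTop, -Λ s / n < ε / 4 :=
    (tendsto_const_div_atTop_nhds_zero_nat (-Λ s)).eventually_lt_const (by linarith)
  filter_upwards [hlow' (ε / 2) (by linarith), hpos, hsmall, eventually_gt_atTop 0]
    with n hn1 hn2 hn3 hn4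
  have hn : (0 : ℝ) < n := by exact_mod_cast hn4
  have hlo : (κ n : ℝ) * (-L - ε / 2) ≤ Real.log (P n) := by
    rwa [Real.le_log_iff_exp_le hn2]
  have hhi : Real.log (P n) ≤ -s * n + κ n * Λ s := by
    rw [Real.log_le_iff_le_exp hn2]
    exact hup s hs n
  have hlo2 : y * (-L - ε / 2) ≤ 1 / n * Real.log (P n) := by
    rw [one_div, ← div_eq_inv_mul, le_div_iff₀ hn]
    refine le_trans ?_ hlo
    have := mul_le_mul_of_nonneg_right (hκ2 n) (by linarith : 0 ≤ L + ε / 2)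
    linarith
  have hhi2 : 1 / n * Real.log (P n) ≤ -s + y * Λ s + -Λ s / n := by
    rw [one_div, ← div_eq_inv_mul, div_le_iff₀ hn, add_mul, div_mul_cancel₀ _ hn.ne']
    refine hhi.trans ?_
    have := mul_le_mul_of_nonpos_right (hκ1 n) hΛs
    linarith
  have hval : -s + y * Λ s = -(y * (s * (1 / y) - Λ s)) := by
    field_simp
    ring
  have h5 : y * (L - ε / 4) ≤ y * (s * (1 / y) - Λ s) := by gcongr
  have h6 : y * ε ≤ ε := mul_le_of_le_one_left hε.le hy1
  rw [Real.dist_eq, abs_lt]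
  constructor <;> linarith

end LargeDeviations

/-! ### The law of large numbers for the number of records -/

/-- Sandwich: with `R` records up to `n`, `recordTime (R - 1) ≤ n < recordTime R`, and both bounds
divided by `R` tend to `m`. -/
lemma tendsto_numRecords_div {x : ℕ → ℝ} {m : ℝ} (hm : 0 < m)
    (hx : ∀ i, ∃ n, 1 ≤ n ∧ HasRecord (afterRecord^[i] x) n)
    (hlim : Tendsto (fun k : ℕ => (recordTime k x : ℝ) / k) atTop (𝓝 m)) :
    Tendsto (fun n : ℕ => (numRecords x n : ℝ) / n) atTop (𝓝 (1 / m)) := by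
  have hiff : ∀ k n, recordTime k x ≤ n ↔ k + 1 ≤ numRecords x n :=
    fun k n => recordTime_le_iff hx n
  have hN1 : Tendsto (fun n => numRecords x n - 1) atTop atTop := by
    refine tendsto_atTop.2 fun k => ?_
    filter_upwards [eventually_ge_atTop (recordTime k x)] with n hn
    have := (hiff k n).1 hn
    omega
  have hN : Tendsto (fun n => numRecords x n) atTop atTop :=
    tendsto_atTop_mono (fun n => Nat.sub_le _ _) hN1
  have hinv : Tendsto (fun k : ℕ => (k : ℝ) / recordTime k x) atTop (𝓝 (1 / m)) := by
    rw [one_div]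
    refine (hlim.inv₀ hm.ne').congr fun k => ?_
    rw [inv_div]
  have hlow := hinv.comp hN
  have hratio : Tendsto (fun k : ℕ => ((k : ℝ) + 1) / k) atTop (𝓝 1) := by
    have h1 : Tendsto (fun k : ℕ => 1 + 1 / (k : ℝ)) atTop (𝓝 (1 + 0)) :=
      tendsto_const_nhds.add tendsto_one_div_atTop_nhds_zero_nat
    rw [add_zero] at h1
    refine h1.congr' ?_
    filter_upwards [eventually_gt_atTop 0] with k hk
    have : (k : ℝ) ≠ 0 := by positivity
    field_simp
  have hup := (hratio.mul hinv).comp hN1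
  rw [one_mul] at hup
  have hposev : ∀ᶠ k : ℕ in atTop, 0 < recordTime k x := by
    filter_upwards [hlim.eventually (lt_mem_nhds hm)] with k hk
    by_contra h0
    rw [Nat.pos_iff_ne_zero, not_not] at h0
    simp [h0] at hk
  refine tendsto_of_tendsto_of_tendsto_of_le_of_le' hlow hup ?_ ?_
  · filter_upwards [eventually_gt_atTop 0] with n hn
    have h1 : n < recordTime (numRecords x n) x := by
      by_contra hcon
      have := (hiff _ n).1 (not_lt.1 hcon)
      omega
    have h2 : (0 : ℝ) < n := by exact_mod_cast hn
    have h3 : (n : ℝ) ≤ recordTime (numRecords x n) x := by exact_mod_cast h1.le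
    exact div_le_div_of_nonneg_left (Nat.cast_nonneg _) h2 h3
  · filter_upwards [hN1.eventually hposev, hN1.eventually_gt_atTop 0] with n hn hk
    have h1 := one_le_numRecords x n
    have h2 : recordTime (numRecords x n - 1) x ≤ n := (hiff _ n).2 (by omega)
    have h3 : (recordTime (numRecords x n - 1) x : ℝ) ≤ n := by exact_mod_cast h2
    have h4 : (0 : ℝ) < recordTime (numRecords x n - 1) x := by exact_mod_cast hn
    have h5 : (0 : ℝ) < ((numRecords x n - 1 : ℕ) : ℝ) := by exact_mod_cast hk
    have h6 : (((numRecords x n - 1 : ℕ) : ℝ) + 1) = numRecords x n := by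
      rw [Nat.cast_sub h1]
      simp
    simp only [Function.comp]
    rw [h6, div_mul_div_cancel₀ h5.ne']
    exact div_le_div_of_nonneg_left (Nat.cast_nonneg _) h4 h3

lemma ae_tendsto_numRecords_div (h : RecordsOccur ρ)
    (hfin : ∫⁻ x, (firstRecord x : ℝ≥0∞) ∂(seqLaw ρ) ≠ ⊤) :
    ∀ᵐ x ∂(seqLaw ρ), Tendsto (fun n : ℕ => (numRecords x n : ℝ) / n) atTop
      (𝓝 (1 / ∫ x, (firstRecord x : ℝ) ∂(seqLaw ρ))) := by
  have hint := integrable_firstRecord hfin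
  have hpos : 0 < ∫ x, (firstRecord x : ℝ) ∂(seqLaw ρ) := by
    rw [(mean_firstRecord h hfin).2]
    exact Real.exp_pos _
  have hslln := strong_law_ae_real (μ := seqLaw ρ)
    (fun i x => (firstRecord (afterRecord^[i] x) : ℝ)) hint
    (by
      intro i j hij
      rcases lt_or_gt_of_ne hij with hlt | hlt
      · exact indepFun_firstRecord_of_lt h hlt
      · exact (indepFun_firstRecord_of_lt h hlt).symm)
    (identDistrib_firstRecord h)
  filter_upwards [ae_forall_iterate h, hslln] with x hx hlim
  refine tendsto_numRecords_div hpos hx ?_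
  refine hlim.congr fun k => ?_
  rw [recordTime_eq_sum]
  push_cast
  rfl

/-! ### Lower large deviations of the number of records -/

lemma setOf_firstRecord_eq_one :
    {x : ℕ → ℝ | firstRecord x = 1} = {x | 0 ≤ x 0} :=
  Set.ext firstRecord_eq_one_iff

/-- Having at least `r ≥ 1` records, index 0 included, means that the `(r - 1)`-st positive record
has occurred. Requiring `n > 0` makes `r = ⌈n y⌉₊` positive, so the truncated subtraction is exact.
-/
lemma measure_le_numRecords (h : RecordsOccur ρ) {y : ℝ} (hy : 0 < y) {n : ℕ} (hn : 0 < n) :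
    seqLaw ρ {x | (n : ℝ) * y ≤ numRecords x n} =
      seqLaw ρ {x | recordTime (⌈(n : ℝ) * y⌉₊ - 1) x ≤ n} := by
  refine measure_congr ?_
  filter_upwards [ae_forall_iterate h] with x hx
  refine propext ?_
  change (n : ℝ) * y ≤ numRecords x n ↔ recordTime (⌈(n : ℝ) * y⌉₊ - 1) x ≤ n
  have hpos : 0 < ⌈(n : ℝ) * y⌉₊ := Nat.ceil_pos.2 (by positivity)
  rw [recordTime_le_iff hx, ← Nat.ceil_le]
  omega

lemma coe_iSup_Iic_eq {f : ℝ → ℝ} {L : ℝ} (hL : IsLUB (f '' Iic 0) L) :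
    ⨆ t : Iic (0 : ℝ), ((f t : ℝ) : EReal) = (L : EReal) := by
  refine le_antisymm (iSup_le fun t => ?_) ?_
  · exact EReal.coe_le_coe_iff.2 (hL.1 ⟨t, t.2, rfl⟩)
  · refine le_of_forall_lt fun c hc => ?_
    obtain ⟨q, hq1, hq2⟩ := EReal.lt_iff_exists_real_btwn.1 hc
    obtain ⟨_, ⟨t, ht, rfl⟩, hlt⟩ := (lt_isLUB_iff hL).1 (EReal.coe_lt_coe_iff.1 hq2)
    exact (hq1.trans (EReal.coe_lt_coe_iff.2 hlt)).trans_le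
      (le_iSup (fun t : Iic (0 : ℝ) => ((f t : ℝ) : EReal)) ⟨t, ht⟩)

lemma isLUB_of_forall_le {f : ℝ → ℝ} {t : ℝ} (ht : t ≤ 0) (h : ∀ s ≤ 0, f s ≤ f t) :
    IsLUB (f '' Iic 0) (f t) :=
  IsGreatest.isLUB ⟨⟨t, ht, rfl⟩, by rintro _ ⟨s, hs, rfl⟩; exact h s hs⟩

lemma tendsto_log_measure_numRecords (h : RecordsOccur ρ) {y : ℝ} (hy0 : 0 < y) (hy1 : y ≤ 1)
    (hy : y < 1 → ENNReal.ofReal (1 / y) < ∫⁻ x, (firstRecord x : ℝ≥0∞) ∂(seqLaw ρ)) :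
    Tendsto (fun n : ℕ => ((1 / (n : ℝ) : ℝ) : EReal) *
        ENNReal.log (seqLaw ρ {x | (n : ℝ) * y ≤ numRecords x n})) atTop
      (𝓝 (-((y : EReal) * ⨆ t : Iic (0 : ℝ),
        ((t * (1 / y) - cgf (fun x => (firstRecord x : ℝ)) (seqLaw ρ) t : ℝ) : EReal)))) := by
  have hp : 0 < (seqLaw ρ).real {x | firstRecord x = 1} := by
    rw [setOf_firstRecord_eq_one]
    exact measure_nonneg_step_pos h
  have hT := measurable_firstRecord
  have h1 := ae_one_le_firstRecord h
  have hexists : ∃ L, IsLUB ((fun t => t * (1 / y) -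
      cgf (fun x => (firstRecord x : ℝ)) (seqLaw ρ) t) '' Iic 0) L ∧
      ∀ ε > 0, ∀ᶠ k : ℕ in atTop, Real.exp (k * (-L - ε)) ≤
        (seqLaw ρ).real {x | (recordTime k x : ℝ) ≤ k * (1 / y)} := by
    -- For `y = 1` the level `1 / y` is the minimal value of `T`, and runs of nonnegative steps give
    -- the lower bound. For `y < 1` it is given by the critical point of the Legendre transform.
    rcases hy1.eq_or_lt with rfl | hlt
    · refine ⟨_, by simpa using isLUB_one hT h1 hp, fun ε hε => Eventually.of_forall fun k => ?_⟩
      have h2 := le_measure_recordTime_le (ρ := ρ) k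
      simp only [one_div_one, mul_one, Nat.cast_le]
      refine le_trans ?_ h2
      rw [neg_neg, ← Real.exp_log (pow_pos hp k), Real.log_pow]
      refine Real.exp_le_exp.2 (mul_le_mul_of_nonneg_left (by linarith) (Nat.cast_nonneg k))
    · have hy' : 1 < 1 / y := by rwa [lt_one_div one_pos hy0, div_one]
      obtain ⟨t, ht, hd, hmax⟩ := exists_deriv_cgf_eq hT hp hy' (hy hlt)
      refine ⟨_, isLUB_of_forall_le ht.le hmax, fun ε hε => ?_⟩
      exact le_measure_lowerTail hT measurable_recordTime (mgf_recordTime h)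
        (strictMonoOn_deriv_cgf hT hp (not_ae_eq_one hy' (hy hlt))) ht hd hε
  obtain ⟨L, hL, hlow⟩ := hexists
  obtain ⟨hpos, hlim⟩ := tendsto_log_measure_lowerTail hT h1 (mgf_recordTime h)
    measurable_recordTime hy0 hy1 hL hlow
  rw [coe_iSup_Iic_eq hL, ← EReal.coe_mul, ← EReal.coe_neg]
  refine ((continuous_coe_real_ereal.tendsto _).comp hlim).congr' ?_
  filter_upwards [hpos, eventually_gt_atTop 0] with n hn hn0
  rw [measure_le_numRecords h hy0 hn0]
  set E := {x : ℕ → ℝ | recordTime (⌈(n : ℝ) * y⌉₊ - 1) x ≤ n} with hE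
  have h3 : seqLaw ρ E = ENNReal.ofReal ((seqLaw ρ).real E) := by
    rw [measureReal_def, ENNReal.ofReal_toReal (measure_ne_top _ _)]
  rw [h3, ENNReal.log_ofReal_of_pos hn]
  exact EReal.coe_mul _ _

lemma iSup_legendre_one (h : RecordsOccur ρ) :
    (⨆ t : Iic (0 : ℝ), ((t * 1 - cgf (fun x => (firstRecord x : ℝ)) (seqLaw ρ) t : ℝ) : EReal)) =
      -ENNReal.log (seqLaw ρ {x | 0 ≤ x 0}) := by
  have hp := measure_nonneg_step_pos h
  have hp' := hp
  rw [← setOf_firstRecord_eq_one] at hp'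
  have h3 : seqLaw ρ {x | 0 ≤ x 0} = ENNReal.ofReal ((seqLaw ρ).real {x | 0 ≤ x 0}) := by
    rw [measureReal_def, ENNReal.ofReal_toReal (measure_ne_top _ _)]
  rw [coe_iSup_Iic_eq (isLUB_one measurable_firstRecord (ae_one_le_firstRecord h) hp'), h3,
    ENNReal.log_ofReal_of_pos hp, setOf_firstRecord_eq_one, EReal.coe_neg]

/-- Since `T ≥ 1`, `Λ(t) ≤ t`, so `t y - Λ(t) ≥ t (y - 1)`, which is unbounded as `t → -∞`. -/
lemma iSup_legendre_eq_top (h : RecordsOccur ρ) {y : ℝ} (hy : y < 1) :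
    (⨆ t : Iic (0 : ℝ),
      ((t * y - cgf (fun x => (firstRecord x : ℝ)) (seqLaw ρ) t : ℝ) : EReal)) = ⊤ := by
  rw [EReal.eq_top_iff_forall_lt]
  intro c
  set t := min 0 ((c + 1) / (y - 1)) with ht
  have ht0 : t ≤ 0 := min_le_left _ _
  have h2 : t ≤ (c + 1) / (y - 1) := min_le_right _ _
  rw [le_div_iff_of_neg (by linarith)] at h2
  have h3 := cgf_natCast_le measurable_firstRecord (ae_one_le_firstRecord h) ht0
  refine lt_of_lt_of_le ?_ (le_iSup (fun t : Iic (0 : ℝ) =>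
    ((t * y - cgf (fun x => (firstRecord x : ℝ)) (seqLaw ρ) t : ℝ) : EReal)) ⟨t, ht0⟩)
  rw [EReal.coe_lt_coe_iff]
  dsimp only
  linarith

lemma legendre_interior (h : RecordsOccur ρ) {y : ℝ} (h1 : 1 < y)
    (hy : ENNReal.ofReal y < ∫⁻ x, (firstRecord x : ℝ≥0∞) ∂(seqLaw ρ)) :
    (∃! t : ℝ, t < 0 ∧ deriv (cgf (fun x => (firstRecord x : ℝ)) (seqLaw ρ)) t = y) ∧
    (⨆ t : Iic (0 : ℝ), ((t * y - cgf (fun x => (firstRecord x : ℝ)) (seqLaw ρ) t : ℝ) : EReal)) =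
      ((Function.invFunOn (deriv (cgf (fun x => (firstRecord x : ℝ)) (seqLaw ρ))) (Iio 0) y * y -
        cgf (fun x => (firstRecord x : ℝ)) (seqLaw ρ)
          (Function.invFunOn (deriv (cgf (fun x => (firstRecord x : ℝ)) (seqLaw ρ))) (Iio 0) y) :
        ℝ) : EReal) := by
  have hp : 0 < (seqLaw ρ).real {x | firstRecord x = 1} := by
    rw [setOf_firstRecord_eq_one]
    exact measure_nonneg_step_pos h
  have hT := measurable_firstRecord
  obtain ⟨t, ht, hd, hmax⟩ := exists_deriv_cgf_eq hT hp h1 hy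
  have hinj := (strictMonoOn_deriv_cgf hT hp (not_ae_eq_one h1 hy)).injOn
  refine ⟨⟨t, ⟨ht, hd⟩, fun s hs => hinj hs.1 ht (hs.2.trans hd.symm)⟩, ?_⟩
  have hinv : Function.invFunOn (deriv (cgf (fun x => (firstRecord x : ℝ)) (seqLaw ρ)))
      (Iio 0) y = t := by
    have hex : ∃ s ∈ Iio (0 : ℝ), deriv (cgf (fun x => (firstRecord x : ℝ)) (seqLaw ρ)) s = y :=
      ⟨t, ht, hd⟩
    exact hinj (Function.invFunOn_mem hex) ht ((Function.invFunOn_eq hex).trans hd.symm)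
  rw [hinv]
  exact coe_iSup_Iic_eq (isLUB_of_forall_le ht.le hmax)

/-! ### Transfer to the canonical space -/

lemma ladderEpoch_eq {Ω : Type*} {X : ℕ → Ω → ℝ} {ω : Ω}
    (h : ∃ n, 1 ≤ n ∧ HasRecord (fun i => X i ω) n) :
    ladderEpoch X ω = (firstRecord (fun i => X i ω) : ℕ∞) := by
  refine le_antisymm (iInf₂_le (firstRecord fun i => X i ω) (firstRecord_spec h)) ?_
  refine le_iInf₂ fun n hn => ?_
  exact Nat.cast_le.2 (firstRecord_le hn.1 hn.2)

/-- No exceptional set is needed: without a positive record, `toNat` at `∞` and the infimum of the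
empty set of naturals are both 0. -/
lemma ladderEpoch_toNat {Ω : Type*} (X : ℕ → Ω → ℝ) (ω : Ω) :
    (ladderEpoch X ω).toNat = firstRecord (fun i => X i ω) := by
  by_cases h : ∃ n, 1 ≤ n ∧ HasRecord (fun i => X i ω) n
  · rw [ladderEpoch_eq h, ENat.toNat_natCast]
  · have h1 : {n | 1 ≤ n ∧ HasRecord (fun i => X i ω) n} = ∅ :=
      eq_empty_of_forall_notMem fun n hn => h ⟨n, hn⟩
    have h2 : {n | 1 ≤ n ∧ IsRecord X ω n} = ∅ := h1
    rw [firstRecord, h1, ladderEpoch, h2]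
    simp

section Transfer

variable {Ω : Type*} [MeasurableSpace Ω] {μ : Measure Ω} {X : ℕ → Ω → ℝ}

/-- Every quantity in the theorem depends on the path of steps alone, so this identification reduces
it to the product law. -/
lemma map_steps [IsProbabilityMeasure μ] (hmeas : ∀ i, Measurable (X i)) (hindep : iIndepFun X μ)
    (hident : ∀ i, IdentDistrib (X i) (X 0) μ μ) [IsProbabilityMeasure (μ.map (X 0))] :
    μ.map (fun ω i => X i ω) = seqLaw (μ.map (X 0)) := by
  rw [hindep.map_fun_eq_infinitePi_map hmeas]
  congr 1
  funext i
  exact (hident i).map_eq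

lemma measure_steps (hX : Measurable fun ω i => X i ω)
    (hmap : μ.map (fun ω i => X i ω) = seqLaw ρ) {A : Set (ℕ → ℝ)} (hA : MeasurableSet A) :
    μ {ω | (fun i => X i ω) ∈ A} = seqLaw ρ A := by
  rw [← hmap, Measure.map_apply hX hA]
  rfl

lemma measurableSet_exists_record : MeasurableSet {x : ℕ → ℝ | ∃ n, 1 ≤ n ∧ HasRecord x n} := by
  simp only [ofPred_exists, ofPred_and]
  exact MeasurableSet.iUnion fun n => (MeasurableSet.const _).inter (measurableSet_hasRecord n)

lemma recordsOccur_of_ae (hX : Measurable fun ω i => X i ω)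
    (hmap : μ.map (fun ω i => X i ω) = seqLaw ρ) (h : ∀ᵐ ω ∂μ, ∃ n, 0 < walk X n ω) :
    RecordsOccur ρ := by
  rw [RecordsOccur, ← hmap, ae_map_iff hX.aemeasurable measurableSet_exists_record]
  filter_upwards [h] with ω hω
  obtain ⟨n, hn⟩ := hω
  exact exists_record_of_pos (x := fun i => X i ω) hn

lemma ladderCgf_eq (hX : Measurable fun ω i => X i ω)
    (hmap : μ.map (fun ω i => X i ω) = seqLaw ρ) :
    ladderCgf X μ = cgf (fun x => (firstRecord x : ℝ)) (seqLaw ρ) := by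
  funext t
  simp only [ladderCgf, ladderEpoch_toNat, cgf]
  rw [← hmap, mgf_map hX.aemeasurable]
  · rfl
  · exact ((measurable_from_top.comp measurable_firstRecord).const_mul t).exp.aestronglyMeasurable

lemma meanLadderEpoch_eq (hX : Measurable fun ω i => X i ω)
    (hmap : μ.map (fun ω i => X i ω) = seqLaw ρ) (h : RecordsOccur ρ) :
    meanLadderEpoch X μ = ∫⁻ x, (firstRecord x : ℝ≥0∞) ∂(seqLaw ρ) := by
  have hr : ∀ᵐ ω ∂μ, ∃ n, 1 ≤ n ∧ HasRecord (fun i => X i ω) n := by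
    rw [RecordsOccur, ← hmap] at h
    exact ae_of_ae_map hX.aemeasurable h
  rw [meanLadderEpoch, ← hmap, lintegral_map
    (f := fun x => (firstRecord x : ℝ≥0∞)) (measurable_from_top.comp measurable_firstRecord) hX]
  refine lintegral_congr_ae ?_
  filter_upwards [hr] with ω hω
  rw [ladderEpoch_eq hω]
  simp

lemma measure_recordCount_eq (hX : Measurable fun ω i => X i ω)
    (hmap : μ.map (fun ω i => X i ω) = seqLaw ρ) (n : ℕ) (r : ℝ) :
    μ {ω | r ≤ (recordCount X n ω : ℝ)} = seqLaw ρ {x | r ≤ (numRecords x n : ℝ)} :=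
  measure_steps hX hmap (A := {x | r ≤ (numRecords x n : ℝ)})
    (measurableSet_le measurable_const (measurable_from_top.comp (measurable_numRecords n)))

lemma measure_staysNonneg_eq_zero (hX : Measurable fun ω i => X i ω)
    (hmap : μ.map (fun ω i => X i ω) = seqLaw ρ) (h : ∀ᵐ ω ∂μ, ∃ n, walk X n ω < 0) :
    seqLaw ρ {x | ∀ i, 0 ≤ partialSum x i} = 0 := by
  have hm : MeasurableSet {x : ℕ → ℝ | ∀ i, 0 ≤ partialSum x i} := by
    rw [ofPred_forall]
    exact MeasurableSet.iInter fun i => measurableSet_nonneg_partialSum i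
  rw [← measure_steps hX hmap hm]
  refine measure_mono_null ?_ (ae_iff.1 h)
  intro ω hω
  simp only [mem_ofPred_eq, not_exists, not_lt]
  exact hω

lemma ae_tendsto_partialSum (hX : Measurable fun ω i => X i ω)
    (hmap : μ.map (fun ω i => X i ω) = seqLaw ρ) (h : DriftsToInfinity X μ) :
    ∀ᵐ x ∂(seqLaw ρ), Tendsto (partialSum x) atTop atTop := by
  rw [← hmap, ae_map_iff hX.aemeasurable (measurableSet_tendsto atTop measurable_partialSum)]
  exact h

end Transfer

end RandomWalk

/-! ### Conclusion for oscillating walks and for walks drifting to `+∞` -/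

theorem mainTheorem6 {Ω : Type*} [MeasurableSpace Ω] (μ : Measure Ω) [IsProbabilityMeasure μ]
    (X : ℕ → Ω → ℝ) (hmeas : ∀ i, Measurable (X i)) (hindep : iIndepFun X μ)
    (hident : ∀ i, IdentDistrib (X i) (X 0) μ μ) :
    (RandomWalk.Oscillates X μ →
      (∀ y : ℝ, 0 < y → y ≤ 1 →
        Tendsto (fun n : ℕ => ((1 / (n : ℝ) : ℝ) : EReal) *
            ENNReal.log (μ {ω | (n : ℝ) * y ≤ (RandomWalk.recordCount X n ω : ℝ)}))
          atTop (𝓝 (-((y : EReal) * RandomWalk.ladderRate X μ (1 / y))))) ∧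
      DifferentiableOn ℝ (RandomWalk.ladderCgf X μ) (Iio 0) ∧
      (∀ y : ℝ, 1 < y →
        (∃! t : ℝ, t < 0 ∧ deriv (RandomWalk.ladderCgf X μ) t = y) ∧
        RandomWalk.ladderRate X μ y =
          ((RandomWalk.ladderCgfDerivInv X μ y * y -
            RandomWalk.ladderCgf X μ (RandomWalk.ladderCgfDerivInv X μ y) : ℝ) : EReal)) ∧
      RandomWalk.ladderRate X μ 1 = -ENNReal.log (μ {ω | 0 ≤ X 0 ω}) ∧
      (∀ y : ℝ, y < 1 → RandomWalk.ladderRate X μ y = ⊤)) ∧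
    (RandomWalk.DriftsToInfinity X μ →
      Summable (fun k : ℕ => μ.real {ω | RandomWalk.walk X (k + 1) ω < 0} / ((k : ℝ) + 1)) ∧
      RandomWalk.meanLadderEpoch X μ = ENNReal.ofReal (Real.exp
        (∑' k : ℕ, μ.real {ω | RandomWalk.walk X (k + 1) ω < 0} / ((k : ℝ) + 1))) ∧
      (∀ᵐ ω ∂μ, Tendsto (fun n : ℕ => (RandomWalk.recordCount X n ω : ℝ) / (n : ℝ)) atTop
        (𝓝 (1 / (RandomWalk.meanLadderEpoch X μ).toReal))) ∧
      (∀ y : ℝ, 1 / (RandomWalk.meanLadderEpoch X μ).toReal < y → y ≤ 1 →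
        Tendsto (fun n : ℕ => ((1 / (n : ℝ) : ℝ) : EReal) *
            ENNReal.log (μ {ω | (n : ℝ) * y ≤ (RandomWalk.recordCount X n ω : ℝ)}))
          atTop (𝓝 (-((y : EReal) * RandomWalk.ladderRate X μ (1 / y))))) ∧
      DifferentiableOn ℝ (RandomWalk.ladderCgf X μ) (Iio 0) ∧
      (∀ y : ℝ, 1 < y → y < (RandomWalk.meanLadderEpoch X μ).toReal →
        (∃! t : ℝ, t < 0 ∧ deriv (RandomWalk.ladderCgf X μ) t = y) ∧
        RandomWalk.ladderRate X μ y =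
          ((RandomWalk.ladderCgfDerivInv X μ y * y -
            RandomWalk.ladderCgf X μ (RandomWalk.ladderCgfDerivInv X μ y) : ℝ) : EReal)) ∧
      RandomWalk.ladderRate X μ 1 = -ENNReal.log (μ {ω | 0 ≤ X 0 ω}) ∧
      (∀ y : ℝ, y < 1 → RandomWalk.ladderRate X μ y = ⊤)) := by
  have := Measure.isProbabilityMeasure_map (μ := μ) (hmeas 0).aemeasurable
  have hX : Measurable fun ω i => X i ω := measurable_pi_iff.2 hmeas
  have hmap := RandomWalk.map_steps hmeas hindep hident
  have hcgf := RandomWalk.ladderCgf_eq hX hmap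
  have hstep : μ {ω | 0 ≤ X 0 ω} = RandomWalk.seqLaw (μ.map (X 0)) {x | 0 ≤ x 0} :=
    RandomWalk.measure_steps hX hmap (A := {x | 0 ≤ x 0})
      (measurableSet_le measurable_const (measurable_pi_apply 0))
  have hdiff : DifferentiableOn ℝ (RandomWalk.ladderCgf X μ) (Iio 0) := by
    rw [hcgf]
    exact (RandomWalk.analyticOnNhd_cgf_natCast RandomWalk.measurable_firstRecord).differentiableOn
  simp only [RandomWalk.measure_recordCount_eq hX hmap, RandomWalk.ladderRate,
    RandomWalk.ladderCgfDerivInv, hcgf, hstep] at hdiff ⊢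
  constructor
  · intro hosc
    have hrec : RandomWalk.RecordsOccur (μ.map (X 0)) := by
      refine RandomWalk.recordsOccur_of_ae hX hmap ?_
      filter_upwards [hosc] with ω hω
      obtain ⟨n, hn⟩ := (frequently_lt_of_lt_limsup (b := (0 : EReal)) (h := by
        rw [hω.1]
        exact EReal.zero_lt_top)).exists
      exact ⟨n, by exact_mod_cast hn⟩
    -- Oscillation enters only through visits to both half-lines: positive values give records,
    -- negative values make the mean of `T` infinite, so every level lies below it.
    have hzero := RandomWalk.measure_staysNonneg_eq_zero hX hmap (by
      filter_upwards [hosc] with ω hω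
      obtain ⟨n, hn⟩ := (frequently_lt_of_liminf_lt (b := (0 : EReal)) (h := by
        rw [hω.2]
        exact EReal.bot_lt_zero)).exists
      exact ⟨n, by exact_mod_cast hn⟩)
    have htop := RandomWalk.lintegral_firstRecord_eq_top hrec hzero
    have hlt : ∀ y : ℝ, ENNReal.ofReal y <
        ∫⁻ x, (RandomWalk.firstRecord x : ℝ≥0∞) ∂(RandomWalk.seqLaw (μ.map (X 0))) := fun y => by
      rw [htop]
      exact ENNReal.ofReal_lt_top
    exact ⟨fun y hy0 hy1 => RandomWalk.tendsto_log_measure_numRecords hrec hy0 hy1 fun _ => hlt _,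
      hdiff, fun y hy => RandomWalk.legendre_interior hrec hy (hlt y),
      RandomWalk.iSup_legendre_one hrec, fun y hy => RandomWalk.iSup_legendre_eq_top hrec hy⟩
  · intro hdrift
    have hrec : RandomWalk.RecordsOccur (μ.map (X 0)) := by
      refine RandomWalk.recordsOccur_of_ae hX hmap ?_
      filter_upwards [hdrift] with ω hω
      exact (hω.eventually_gt_atTop 0).exists
    have hfin := RandomWalk.lintegral_firstRecord_ne_top hrec
      (RandomWalk.measure_staysNonneg_ne_zero_of_tendsto
        (RandomWalk.ae_tendsto_partialSum hX hmap hdrift))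
    have hint := RandomWalk.integrable_firstRecord hfin
    obtain ⟨hsum, hmean⟩ := RandomWalk.mean_firstRecord hrec hfin
    have hneg : ∀ k : ℕ, μ.real {ω | RandomWalk.walk X (k + 1) ω < 0} =
        (RandomWalk.seqLaw (μ.map (X 0))).real {x | RandomWalk.partialSum x (k + 1) < 0} :=
      fun k => congrArg ENNReal.toReal (RandomWalk.measure_steps hX hmap
        (A := {x | RandomWalk.partialSum x (k + 1) < 0})
        (measurableSet_lt (RandomWalk.measurable_partialSum _) measurable_const))
    have hE : RandomWalk.meanLadderEpoch X μ = ENNReal.ofReal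
        (∫ x, (RandomWalk.firstRecord x : ℝ) ∂(RandomWalk.seqLaw (μ.map (X 0)))) := by
      rw [RandomWalk.meanLadderEpoch_eq hX hmap hrec,
        ofReal_integral_eq_lintegral_ofReal hint (ae_of_all _ fun _ => Nat.cast_nonneg _)]
      simp
    have hpos : 0 < ∫ x, (RandomWalk.firstRecord x : ℝ) ∂(RandomWalk.seqLaw (μ.map (X 0))) := by
      rw [hmean]
      exact Real.exp_pos _
    have hEreal : (RandomWalk.meanLadderEpoch X μ).toReal =
        ∫ x, (RandomWalk.firstRecord x : ℝ) ∂(RandomWalk.seqLaw (μ.map (X 0))) := by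
      rw [hE, ENNReal.toReal_ofReal hpos.le]
    have hlt : ∀ y : ℝ, y < (RandomWalk.meanLadderEpoch X μ).toReal → ENNReal.ofReal y <
        ∫⁻ x, (RandomWalk.firstRecord x : ℝ≥0∞) ∂(RandomWalk.seqLaw (μ.map (X 0))) := by
      intro y hy
      rw [← RandomWalk.meanLadderEpoch_eq hX hmap hrec, hE]
      rw [hEreal] at hy
      exact (ENNReal.ofReal_lt_ofReal_iff hpos).2 hy
    simp only [hneg]
    refine ⟨hsum, by rw [hE, hmean], ?_, fun y hy0 hy1 => ?_, hdiff,
      fun y hy hy' => RandomWalk.legendre_interior hrec hy (hlt y hy'),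
      RandomWalk.iSup_legendre_one hrec, fun y hy => RandomWalk.iSup_legendre_eq_top hrec hy⟩
    · rw [hEreal]
      have hlln := RandomWalk.ae_tendsto_numRecords_div hrec hfin
      rw [← hmap] at hlln
      have hlln' := ae_of_ae_map hX.aemeasurable hlln
      rw [hmap] at hlln'
      exact hlln'
    -- The condition `1 / E T < y` is `1 / y < E T`, the range where lower-tail deviations are
    -- nontrivial.
    · have hypos : 0 < y := lt_of_le_of_lt (by positivity) hy0
      refine RandomWalk.tendsto_log_measure_numRecords hrec hypos hy1 fun _ => hlt _ ?_
      rw [hEreal] at hy0 ⊢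
      exact (one_div_lt hpos hypos).1 hy0
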